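/- **Setting.** Let $G$ be a locally compact, $\sigma$-compact, Hausdorff topological group. Let $A$ and $B$ be separable $\mathbb Z_2$-graded $C^*$-algebras on which $G$ acts by grading-preserving $*$-automorphisms such that $g\mapsto g(a)$ is norm continuous for every element $a$ ("$G$-$C^*$-algebras"). Put $L=[1,\infty)$, $BL=C_0(L,B)$ and $B[0,1]=C([0,1],B)$, where $G$ acts and the grading is defined pointwise. A *continuous field of $G$-$(A,B)$-modules* is a countably generated $\mathbb Z_2$-graded right Hilbert $BL$-module $\mathcal E$ with - an action of $G$ by grading-preserving linear automorphisms such that $(g,\xi)\mapsto g(\xi)$ is norm continuous, $g(\xi b)=g(\xi)g(b)$ and $\langle g(\xi),g(\eta)\rangle=g(\langle\xi,\eta\rangle)$; - an equivariant, grading-preserving $*$-homomorphism $\varphi:A\to\mathcal B(\mathcal E)$ into the adjointable operators on $\mathcal E$. An operator $T\in\mathcal B(\mathcal E)$ induces operators $T_t=T\otimes_{ev_t}1$ on the fibres $\mathcal E_t=\mathcal E\otimes_{ev_t}B$, $t\in L$. Let $\mathcal K(\mathcal E)$ be the ideal of compact operators, let $\mathcal C(\mathcal E)=\{T\in\mathcal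 B(\mathcal E): Tf\in\mathcal K(\mathcal E)\ \forall f\in C_0(L)\}$, and let $\mathcal J(\mathcal E)=\{T\in\mathcal B(\mathcal E):\lim_{t\to\infty}\|T_t\|=0\}$. For $g\in G$ write $g(T)=g\circ T\circ g^{-1}$. An *asymptotic Kasparov $G$-$(A,B)$-module* is a pair $(\mathcal E,F)$, where $\mathcal E$ is a continuous field of $G$-$(A,B)$-modules and $F\in\mathcal B(\mathcal E)$ is odd, $g\mapsto g(F)$ is norm continuous, and for all $a\in A$, $g\in G$ (with $[\,,]$ the graded commutator): - (aKm1) $(F-F^*)\varphi(a)\in\mathcal J(\mathcal E)$; - (aKm2) $[F,\varphi(a)]\in\mathcal J(\mathcal E)$; - (aKm3) $\varphi(a)(F^2-1)\varphi(a)^*\ge 0$ modulo $\mathcal C(\mathcal E)+\mathcal J(\mathcal E)$; - (aKm4) $(g(F)-F)\varphi(a)\in\mathcal J(\mathcal E)$. Let $ke_G(A,B)$ be the collection of all of these. A *homotopy* between $(\mathcal E_0,F_0)$ and $(\mathcal E_1,F_1)$ in $ke_G(A,B)$ is an element $(\mathcal E,F)$ of $ke_G(A,B[0,1])$ whose evaluations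 $(\mathcal E\otimes_{ev_s}BL,\ F\otimes_{ev_s}1)$ at $s=0$ and $s=1$ are (unitarily isomorphic to) $(\mathcal E_0,F_0)$ and $(\mathcal E_1,F_1)$. Let $KE_G(A,B)$ be the quotient of $ke_G(A,B)$ by the equivalence relation generated by homotopy. **Theorem.** The direct sum $(\mathcal E_1,F_1)+(\mathcal E_2,F_2)=(\mathcal E_1\oplus\mathcal E_2,F_1\oplus F_2)$ of asymptotic Kasparov modules induces a well-defined addition on $KE_G(A,B)$, and with this addition $KE_G(A,B)$ is an abelian group. The inverse of the class of $(\mathcal E,F)$ is the class of $(\mathcal E^{op},-F)$, where $\mathcal E^{op}$ is $\mathcal E$ with the opposite grading and the same action of $G$, and a homogeneous $a\in A$ acts on $\mathcal E^{op}$ as $(-1)^{\partial a}\varphi(a)$. -/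

import Mathlib

noncomputable section

open Filter Topology MulOpposite
open scoped ZeroAtInfty RightActions WithCStarModule unitInterval CStarAlgebra

set_option linter.unusedSectionVars false

namespace KETheory

/-! ### `ℤ/2`-graded `G`-`C⋆`-algebras -/

/-- A graded `G`-`C⋆`-algebra structure on the `C⋆`-algebra `A`. The `ℤ/2`-grading is given by its
grading automorphism `grade`: the elements of degree `0` (resp. `1`) are those with `grade a = a`
(resp. `grade a = -a`), so that `grade a = (-1) ^ ∂a • a` for homogeneous `a`. The group acts by
grading preserving `⋆`-automorphisms, and every element is `G`-continuous. -/
class GradedGCStarAlgebra (G A : Type*) [Group G] [TopologicalSpace G]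
    [NonUnitalCStarAlgebra A] where
  act : G → A →⋆ₙₐ[ℂ] A
  act_one : ∀ a, act 1 a = a
  act_mul : ∀ g h a, act (g * h) a = act g (act h a)
  continuous_act : ∀ a, Continuous fun g => act g a
  grade : A →⋆ₙₐ[ℂ] A
  grade_grade : ∀ a, grade (grade a) = a
  grade_act : ∀ g a, grade (act g a) = act g (grade a)


/-- The half-line `L = [1, ∞)`. -/
abbrev HalfLine : Type := Set.Ici (1 : ℝ)

/-- The `C⋆`-algebra `BL = C₀([1, ∞), B)`. -/
abbrev BL (B : Type*) [NonUnitalCStarAlgebra B] : Type _ := C₀(HalfLine, B)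

/-- The usual order of the `C⋆`-algebra `BL` (`x ≤ y` iff `y - x = z⋆ z` for some `z`). -/
instance instPartialOrderBL {B : Type*} [NonUnitalCStarAlgebra B] : PartialOrder (BL B) :=
  CStarAlgebra.spectralOrder _

instance instStarOrderedRingBL {B : Type*} [NonUnitalCStarAlgebra B] : StarOrderedRing (BL B) :=
  CStarAlgebra.spectralOrderedRing _

/-- The `⋆`-homomorphism `1 ⊗ ψ : BL → B'L`, `f ↦ ψ ∘ f`. -/
def BL.map {B B' : Type*} [NonUnitalCStarAlgebra B] [NonUnitalCStarAlgebra B']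
    (ψ : B →⋆ₙₐ[ℂ] B') : BL B →⋆ₙₐ[ℂ] BL B' where
  toFun f :=
    { toFun := fun t => ψ (f t)
      continuous_toFun := (map_continuous ψ).comp f.continuous
      zero_at_infty' := by
        have h := ((map_continuous ψ).tendsto 0).comp (zero_at_infty f)
        rwa [map_zero] at h }
  map_smul' c f := by ext t; simp
  map_zero' := by ext t; simp
  map_add' f g := by ext t; simp
  map_mul' f g := by ext t; simp
  map_star' f := by ext t; simp [map_star]

@[simp] lemma BL.map_apply {B B' : Type*} [NonUnitalCStarAlgebra B] [NonUnitalCStarAlgebra B']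
    (ψ : B →⋆ₙₐ[ℂ] B') (f : BL B) (t : HalfLine) : BL.map ψ f t = ψ (f t) := rfl

/-- The product `f b` of a scalar function `f ∈ C₀(L)` and `b ∈ BL`. -/
def BL.scalarMul {B : Type*} [NonUnitalCStarAlgebra B] (f : C₀(HalfLine, ℂ)) (b : BL B) :
    BL B where
  toFun t := f t • b t
  continuous_toFun := f.continuous.smul b.continuous
  zero_at_infty' := by
    have h := (zero_at_infty f).smul (zero_at_infty b)
    rwa [smul_zero] at h

@[simp] lemma BL.scalarMul_apply {B : Type*} [NonUnitalCStarAlgebra B] (f : C₀(HalfLine, ℂ))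
    (b : BL B) (t : HalfLine) : BL.scalarMul f b t = f t • b t := rfl

/-- The evaluation `ev_s : B[0,1] → B`. -/
def evalAt (B : Type*) [NonUnitalCStarAlgebra B] (s : I) : C(I, B) →⋆ₙₐ[ℂ] B where
  toFun f := f s
  map_smul' _ _ := rfl
  map_zero' := rfl
  map_add' _ _ := rfl
  map_mul' _ _ := rfl
  map_star' _ := rfl

/-- The `⋆`-homomorphism `B[0,1] → B'[0,1]` induced by `ψ : B → B'`. -/
def mapInterval {B B' : Type*} [NonUnitalCStarAlgebra B] [NonUnitalCStarAlgebra B']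
    (ψ : B →⋆ₙₐ[ℂ] B') : C(I, B) →⋆ₙₐ[ℂ] C(I, B') where
  toFun f := ⟨fun s => ψ (f s), (map_continuous ψ).comp f.continuous⟩
  map_smul' c f := by ext s; simp
  map_zero' := by ext s; simp
  map_add' f g := by ext s; simp
  map_mul' f g := by ext s; simp
  map_star' f := by ext s; simp [map_star]

lemma continuous_act_uncurry {G A : Type*} [Group G] [TopologicalSpace G]
    [NonUnitalCStarAlgebra A] [GradedGCStarAlgebra G A] :
    Continuous fun p : G × A => GradedGCStarAlgebra.act p.1 p.2 := by
  refine continuous_iff_continuousAt.2 fun ⟨g₀, a₀⟩ => ?_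
  rw [ContinuousAt, tendsto_iff_dist_tendsto_zero]
  have h1 : Tendsto (fun p : G × A => dist p.2 a₀
      + dist (GradedGCStarAlgebra.act p.1 a₀) (GradedGCStarAlgebra.act g₀ a₀))
      (𝓝 (g₀, a₀)) (𝓝 0) := by
    have hc : Continuous fun p : G × A => dist p.2 a₀
      + dist (GradedGCStarAlgebra.act p.1 a₀) (GradedGCStarAlgebra.act g₀ a₀) :=
      (continuous_snd.dist continuous_const).add
        (((GradedGCStarAlgebra.continuous_act a₀).comp continuous_fst).dist continuous_const)
    simpa using hc.tendsto (g₀, a₀)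
  refine squeeze_zero (fun _ => dist_nonneg) (fun p => ?_) h1
  refine (dist_triangle _ (GradedGCStarAlgebra.act p.1 a₀) _).trans ?_
  gcongr
  rw [dist_eq_norm, dist_eq_norm, ← map_sub]
  exact NonUnitalStarAlgHom.norm_apply_le _ _

/-- `B[0,1] = C([0,1], B)` is a graded `G`-`C⋆`-algebra, with the pointwise operations. -/
instance instGradedGCStarAlgebraInterval {G B : Type*} [Group G] [TopologicalSpace G]
    [NonUnitalCStarAlgebra B] [GradedGCStarAlgebra G B] : GradedGCStarAlgebra G C(I, B) where
  act g := mapInterval (GradedGCStarAlgebra.act g)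
  act_one f := by ext s; exact GradedGCStarAlgebra.act_one (f s)
  act_mul g h f := by ext s; exact GradedGCStarAlgebra.act_mul g h (f s)
  continuous_act f := ContinuousMap.continuous_of_continuous_uncurry _ <|
    continuous_act_uncurry.comp (continuous_fst.prodMk (f.continuous.comp continuous_snd))
  grade := mapInterval (GradedGCStarAlgebra.grade G)
  grade_grade f := by ext s; exact GradedGCStarAlgebra.grade_grade (G := G) (f s)
  grade_act g f := by ext s; exact GradedGCStarAlgebra.grade_act g (f s)

/-- The action of `g ∈ G` on `BL = C₀(L) ⊗ B` (trivial on `C₀(L)`). -/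
def BL.act {G B : Type*} [Group G] [TopologicalSpace G] [NonUnitalCStarAlgebra B]
    [GradedGCStarAlgebra G B] (g : G) : BL B →⋆ₙₐ[ℂ] BL B :=
  BL.map (GradedGCStarAlgebra.act g)

/-- The grading automorphism of `BL = C₀(L) ⊗ B` (with `C₀(L)` trivially graded). -/
def BL.grade (G : Type*) {B : Type*} [Group G] [TopologicalSpace G] [NonUnitalCStarAlgebra B]
    [GradedGCStarAlgebra G B] : BL B →⋆ₙₐ[ℂ] BL B :=
  BL.map (GradedGCStarAlgebra.grade G)

/-! ### Hilbert modules and adjointable operators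

Mathlib's `CStarModule D E` describes left Hilbert modules. A right Hilbert `D`-module is the same
thing as a left Hilbert module over the opposite algebra `Dᵐᵒᵖ`; the right multiplication by `d` is
`ξ <• d = op d • ξ`. -/

section HilbertModule

variable (D : Type*) {E E' : Type*} [NonUnitalCStarAlgebra D] [PartialOrder D] [StarOrderedRing D]
  [NormedAddCommGroup E] [NormedSpace ℂ E] [SMul Dᵐᵒᵖ E] [CStarModule Dᵐᵒᵖ E]
  [NormedAddCommGroup E'] [NormedSpace ℂ E'] [SMul Dᵐᵒᵖ E'] [CStarModule Dᵐᵒᵖ E']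

/-- The `D`-valued inner product of a right Hilbert `D`-module, conjugate linear in the first
variable, and with `⟨ξ, η d⟩ = ⟨ξ, η⟩ d`. -/
def rinner (ξ η : E) : D := unop (inner Dᵐᵒᵖ ξ η)

lemma rinner_smul_right (ξ η : E) (d : D) : rinner D ξ (η <• d) = rinner D ξ η * d := by
  simp [rinner]

lemma rinner_smul_left (ξ η : E) (d : D) : rinner D (ξ <• d) η = star d * rinner D ξ η := by
  simp [rinner]

lemma star_rinner (ξ η : E) : star (rinner D ξ η) = rinner D η ξ := by
  simp [rinner, ← unop_star]

lemma rinner_add_right (ξ η ζ : E) : rinner D ξ (η + ζ) = rinner D ξ η + rinner D ξ ζ := by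
  simp [rinner]

lemma rinner_add_left (ξ η ζ : E) : rinner D (ξ + η) ζ = rinner D ξ ζ + rinner D η ζ := by
  simp [rinner]

lemma rinner_sub_right (ξ η ζ : E) : rinner D ξ (η - ζ) = rinner D ξ η - rinner D ξ ζ := by
  simp [rinner]

lemma rinner_sub_left (ξ η ζ : E) : rinner D (ξ - η) ζ = rinner D ξ ζ - rinner D η ζ := by
  simp [rinner]

lemma rinner_neg_left (ξ ζ : E) : rinner D (-ξ) ζ = -rinner D ξ ζ := by
  simp [rinner]

lemma rinner_neg_right (ξ ζ : E) : rinner D ξ (-ζ) = -rinner D ξ ζ := by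
  simp [rinner]

lemma rinner_csmul_right (c : ℂ) (ξ η : E) : rinner D ξ (c • η) = c • rinner D ξ η := by
  simp [rinner]

lemma rinner_csmul_left (c : ℂ) (ξ η : E) : rinner D (c • ξ) η = star c • rinner D ξ η := by
  simp [rinner]

lemma rinner_zero_right (ξ : E) : rinner D ξ 0 = 0 := by simp [rinner]

lemma rinner_zero_left (ξ : E) : rinner D 0 ξ = 0 := by simp [rinner]

lemma norm_sq_eq_rinner (ξ : E) : ‖ξ‖ ^ 2 = ‖rinner D ξ ξ‖ := by
  rw [CStarModule.norm_sq_eq Dᵐᵒᵖ]; rfl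

lemma rinner_self_nonneg (ξ : E) : 0 ≤ rinner D ξ ξ :=
  CStarModule.inner_self_nonneg (A := Dᵐᵒᵖ) (x := ξ)

lemma norm_rinner_le (ξ η : E) : ‖rinner D ξ η‖ ≤ ‖ξ‖ * ‖η‖ :=
  CStarModule.norm_inner_le (A := Dᵐᵒᵖ) E

lemma ext_rinner {ξ η : E} (h : ∀ ζ, rinner D ζ ξ = rinner D ζ η) : ξ = η := by
  have h2 : inner Dᵐᵒᵖ (ξ - η) (ξ - η) = 0 := by
    apply unop_injective
    change rinner D _ _ = 0
    rw [rinner_sub_right, h, sub_self]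
  exact sub_eq_zero.1 ((CStarModule.inner_self (A := Dᵐᵒᵖ)).1 h2)

lemma smul_add_right (ξ η : E) (d : D) : (ξ + η) <• d = ξ <• d + η <• d :=
  ext_rinner D fun ζ => by simp only [rinner_add_right, rinner_smul_right, add_mul]

lemma smul_csmul_right (c : ℂ) (ξ : E) (d : D) : (c • ξ) <• d = c • (ξ <• d) :=
  ext_rinner D fun ζ => by simp only [rinner_csmul_right, rinner_smul_right, smul_mul_assoc]

lemma smul_sub_left (ξ : E) (d d' : D) : ξ <• (d - d') = ξ <• d - ξ <• d' :=
  ext_rinner D fun ζ => by simp only [rinner_sub_right, rinner_smul_right, mul_sub]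

variable (E) in
/-- The algebra `𝓑(E)` of adjointable operators on the Hilbert `D`-module `E`. -/
def adjointable : Subalgebra ℂ (E →L[ℂ] E) where
  carrier := {T | ∃ S : E →L[ℂ] E, ∀ ξ η, rinner D (T ξ) η = rinner D ξ (S η)}
  mul_mem' := by
    rintro T₁ T₂ ⟨S₁, h₁⟩ ⟨S₂, h₂⟩
    exact ⟨S₂ * S₁, fun ξ η => by simp [h₁, h₂]⟩
  add_mem' := by
    rintro T₁ T₂ ⟨S₁, h₁⟩ ⟨S₂, h₂⟩
    exact ⟨S₁ + S₂, fun ξ η => by simp [h₁, h₂, rinner_add_right, rinner_add_left]⟩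
  algebraMap_mem' c := ⟨algebraMap ℂ _ (star c), fun ξ η => by
    simp [Algebra.algebraMap_eq_smul_one, rinner_csmul_right, rinner_csmul_left]⟩

variable (E) in
/-- The type of adjointable operators on `E`; it carries the operator norm. The underlying bounded
operator of `T : Adj D E` is `T.1`. -/
def Adj : Type _ := adjointable D E

variable {D}

instance instNormedRingAdj : NormedRing (Adj D E) :=
  inferInstanceAs (NormedRing (adjointable D E))

instance instNormedAlgebraAdj : NormedAlgebra ℂ (Adj D E) :=
  inferInstanceAs (NormedAlgebra ℂ (adjointable D E))

/-- The adjointable operator `T` with adjoint `S`. -/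
def Adj.mk (T S : E →L[ℂ] E) (h : ∀ ξ η, rinner D (T ξ) η = rinner D ξ (S η)) : Adj D E :=
  ⟨T, S, h⟩

@[simp] lemma Adj.mk_val (T S : E →L[ℂ] E)
    (h : ∀ ξ η, rinner D (T ξ) η = rinner D ξ (S η)) : (Adj.mk T S h).1 = T := rfl
@[simp] lemma Adj.add_val (T S : Adj D E) : (T + S).1 = T.1 + S.1 := rfl
@[simp] lemma Adj.sub_val (T S : Adj D E) : (T - S).1 = T.1 - S.1 := rfl
@[simp] lemma Adj.neg_val (T : Adj D E) : (-T).1 = -T.1 := rfl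
@[simp] lemma Adj.mul_val (T S : Adj D E) : (T * S).1 = T.1 * S.1 := rfl
@[simp] lemma Adj.smul_val (c : ℂ) (T : Adj D E) : (c • T).1 = c • T.1 := rfl
@[simp] lemma Adj.zero_val : (0 : Adj D E).1 = 0 := rfl
@[simp] lemma Adj.one_val : (1 : Adj D E).1 = 1 := rfl
lemma Adj.norm_def (T : Adj D E) : ‖T‖ = ‖T.1‖ := rfl

/-- The adjoint `T⋆` of an adjointable operator `T`, characterized by `⟨T ξ, η⟩ = ⟨ξ, T⋆ η⟩`. -/
instance instStarAdj : Star (Adj D E) where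
  star T := Adj.mk T.2.choose T.1 fun ξ η => by
    rw [← star_rinner, ← T.2.choose_spec η ξ, star_rinner]

lemma rinner_apply_left (T : Adj D E) (ξ η : E) :
    rinner D (T.1 ξ) η = rinner D ξ ((star T).1 η) := T.2.choose_spec ξ η

lemma rinner_apply_right (T : Adj D E) (ξ η : E) :
    rinner D ξ (T.1 η) = rinner D ((star T).1 ξ) η := by
  rw [← star_rinner, rinner_apply_left, star_rinner]

lemma adj_ext {T S : Adj D E} (h : ∀ ξ η, rinner D ξ (T.1 η) = rinner D ξ (S.1 η)) : T = S :=
  Subtype.ext <| ContinuousLinearMap.ext fun η => ext_rinner D fun ζ => h ζ η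

/-- An operator with the defining property of the adjoint is the adjoint. -/
lemma eq_star_of_rinner {T S : Adj D E}
    (h : ∀ ξ η, rinner D (T.1 ξ) η = rinner D ξ (S.1 η)) : S = star T :=
  adj_ext fun ξ η => by rw [← h, rinner_apply_left]

instance instStarRingAdj : StarRing (Adj D E) where
  star_involutive T := (eq_star_of_rinner fun ξ η => (rinner_apply_right T ξ η).symm).symm
  star_mul T S := (eq_star_of_rinner fun ξ η => by
    simp [rinner_apply_left]).symm
  star_add T S := (eq_star_of_rinner fun ξ η => by
    simp [rinner_apply_left, rinner_add_left, rinner_add_right]).symm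

instance instStarModuleAdj : StarModule ℂ (Adj D E) where
  star_smul c T := (eq_star_of_rinner fun ξ η => by
    simp [rinner_apply_left, rinner_csmul_left, rinner_csmul_right]).symm

/-- Adjointable operators are `D`-linear. -/
lemma adj_smul (T : Adj D E) (ξ : E) (d : D) : T.1 (ξ <• d) = T.1 ξ <• d :=
  ext_rinner D fun ζ => by
    rw [rinner_apply_right, rinner_smul_right, rinner_smul_right, rinner_apply_right]

variable (D E) in
/-- The ideal `𝓚(E)` of compact operators: the closed linear span of the rank one operators
`θ_{ξ,η} : ζ ↦ ξ ⟨η, ζ⟩`. -/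
def compacts : Submodule ℂ (Adj D E) :=
  (Submodule.span ℂ
    {T : Adj D E | ∃ ξ η : E, ∀ ζ, T.1 ζ = ξ <• rinner D η ζ}).topologicalClosure

variable (D E) in
/-- A Hilbert module is countably generated if there is a countable set `S` such that the
linear span of `S D` is dense. -/
def CountablyGenerated : Prop :=
  ∃ S : Set E, S.Countable ∧
    Dense (Submodule.span ℂ {ζ : E | ∃ ξ ∈ S, ∃ d : D, ζ = ξ <• d} : Set E)

end HilbertModule

/-! ### Operators on Hilbert `BL`-modules -/

lemma BL.norm_le_of_forall {B : Type*} [NonUnitalCStarAlgebra B] {b : BL B} {c : ℝ} (hc : 0 ≤ c)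
    (h : ∀ t, ‖b t‖ ≤ c) : ‖b‖ ≤ c := by
  rw [← ZeroAtInftyContinuousMap.norm_toBCF_eq_norm]
  exact (BoundedContinuousFunction.norm_le hc).2 h

lemma BL.norm_apply_le {B : Type*} [NormedAddCommGroup B] (b : C₀(HalfLine, B)) (t : HalfLine) :
    ‖b t‖ ≤ ‖b‖ := by
  rw [← ZeroAtInftyContinuousMap.norm_toBCF_eq_norm]
  exact b.toBCF.norm_coe_le_norm t

section BLModule

variable {B E E' : Type*} [NonUnitalCStarAlgebra B]
  [NormedAddCommGroup E] [NormedSpace ℂ E] [SMul (BL B)ᵐᵒᵖ E] [CStarModule (BL B)ᵐᵒᵖ E]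
  [NormedAddCommGroup E'] [NormedSpace ℂ E'] [SMul (BL B)ᵐᵒᵖ E'] [CStarModule (BL B)ᵐᵒᵖ E']

lemma norm_smul_scalarMul_le (f : C₀(HalfLine, ℂ)) (ξ : E) (e : BL B) :
    ‖ξ <• BL.scalarMul f e‖ ≤ ‖f‖ * ‖ξ <• e‖ := by
  have h : ‖ξ <• BL.scalarMul f e‖ ^ 2 ≤ (‖f‖ * ‖ξ <• e‖) ^ 2 := by
    rw [mul_pow, norm_sq_eq_rinner (BL B) (ξ <• BL.scalarMul f e),
      norm_sq_eq_rinner (BL B) (ξ <• e)]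
    refine BL.norm_le_of_forall (by positivity) fun t => ?_
    have h1 : rinner (BL B) (ξ <• BL.scalarMul f e) (ξ <• BL.scalarMul f e) t
        = (star (f t) * f t) • rinner (BL B) (ξ <• e) (ξ <• e) t := by
      simp only [rinner_smul_right, rinner_smul_left, ZeroAtInftyContinuousMap.mul_apply,
        ZeroAtInftyContinuousMap.star_apply, BL.scalarMul_apply, star_smul, smul_mul_assoc,
        mul_smul_comm, smul_smul, mul_assoc]
      rw [mul_comm (f t)]
    rw [h1, norm_smul, norm_mul, norm_star, ← sq]
    gcongr
    · exact BL.norm_apply_le f t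
    · exact BL.norm_apply_le _ t
  exact le_of_sq_le_sq h (by positivity)

lemma tendsto_smul_approximateUnit (ξ : E) :
    Tendsto (fun u : BL B => ξ <• u) (CStarAlgebra.approximateUnit (BL B)) (𝓝 ξ) := by
  have hl := CStarAlgebra.increasingApproximateUnit (BL B)
  set a := rinner (BL B) ξ ξ with ha
  have h0 : Tendsto (fun u : BL B => 2 * ‖a - a * u‖)
      (CStarAlgebra.approximateUnit (BL B)) (𝓝 0) := by
    have := ((tendsto_const_nhds (x := a)).sub (hl.tendsto_mul_left a)).norm.const_mul 2
    simpa using this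
  have h1 : Tendsto (fun u : BL B => ‖ξ <• u - ξ‖ ^ 2)
      (CStarAlgebra.approximateUnit (BL B)) (𝓝 0) := by
    refine tendsto_of_tendsto_of_tendsto_of_le_of_le' tendsto_const_nhds h0
      (Eventually.of_forall fun u => by positivity) ?_
    filter_upwards [hl.eventually_norm] with u hu
    rw [norm_sq_eq_rinner (BL B)]
    have h2 : rinner (BL B) (ξ <• u - ξ) (ξ <• u - ξ) = (a - a * u) - star u * (a - a * u) := by
      simp only [rinner_sub_left, rinner_sub_right, rinner_smul_left, rinner_smul_right, ← ha,
        mul_sub, sub_mul, mul_assoc]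
      abel
    rw [h2]
    calc _ ≤ ‖a - a * u‖ + ‖star u‖ * ‖a - a * u‖ :=
          (norm_sub_le _ _).trans (by gcongr; exact norm_mul_le _ _)
      _ ≤ ‖a - a * u‖ + 1 * ‖a - a * u‖ := by rw [norm_star]; gcongr
      _ = _ := by ring
  rw [tendsto_iff_norm_sub_tendsto_zero]
  have h3 := h1.sqrt
  simpa [Real.sqrt_sq] using h3

variable (B) in
/-- The action of `f ∈ C₀(L)` on a Hilbert `BL`-module: `f ξ` is the limit of `ξ (f u)`, where `u`
runs through an approximate unit of `BL`. -/
def scalarAct (f : C₀(HalfLine, ℂ)) (ξ : E) : E :=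
  limUnder (CStarAlgebra.approximateUnit (BL B)) fun u => ξ <• BL.scalarMul f u

lemma continuous_rinner_right (η : E) : Continuous fun ξ : E => rinner (BL B) η ξ := by
  refine LipschitzWith.continuous (K := ‖η‖₊) (LipschitzWith.of_dist_le_mul fun ξ ξ' => ?_)
  rw [dist_eq_norm, dist_eq_norm, ← rinner_sub_right]
  exact norm_rinner_le _ _ _

variable [CompleteSpace E]

lemma BL.scalarMul_sub (f : C₀(HalfLine, ℂ)) (b b' : BL B) :
    BL.scalarMul f (b - b') = BL.scalarMul f b - BL.scalarMul f b' := by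
  ext t; simp [smul_sub]

lemma tendsto_scalarAct (f : C₀(HalfLine, ℂ)) (ξ : E) :
    Tendsto (fun u : BL B => ξ <• BL.scalarMul f u) (CStarAlgebra.approximateUnit (BL B))
      (𝓝 (scalarAct B f ξ)) := by
  refine tendsto_nhds_limUnder (cauchy_map_iff_exists_tendsto.1 ?_)
  have hC : Cauchy (map (fun u : BL B => ξ <• u) (CStarAlgebra.approximateUnit (BL B))) :=
    (tendsto_smul_approximateUnit ξ).cauchy_map
  rw [cauchy_map_iff] at hC ⊢
  refine ⟨hC.1, ?_⟩
  have h1 := hC.2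
  rw [Metric.uniformity_eq_comap_nhds_zero, tendsto_comap_iff] at h1 ⊢
  have h2 := h1.const_mul ‖f‖
  rw [mul_zero] at h2
  refine squeeze_zero (fun _ => dist_nonneg) (fun p => ?_) h2
  simp only [Function.comp, dist_eq_norm]
  rw [← smul_sub_left, ← smul_sub_left, ← BL.scalarMul_sub]
  exact norm_smul_scalarMul_le f ξ _

lemma norm_scalarAct_le (f : C₀(HalfLine, ℂ)) (ξ : E) :
    ‖scalarAct B f ξ‖ ≤ ‖f‖ * ‖ξ‖ :=
  le_of_tendsto_of_tendsto' (tendsto_scalarAct f ξ).norm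
    ((tendsto_smul_approximateUnit ξ).norm.const_mul _) fun u => norm_smul_scalarMul_le f ξ u

lemma continuous_scalarMul (f : C₀(HalfLine, ℂ)) :
    Continuous (BL.scalarMul f : BL B → BL B) := by
  refine LipschitzWith.continuous (K := ‖f‖₊) (LipschitzWith.of_dist_le_mul fun b b' => ?_)
  rw [dist_eq_norm, dist_eq_norm, ← BL.scalarMul_sub]
  refine BL.norm_le_of_forall (by positivity) fun t => ?_
  rw [BL.scalarMul_apply, norm_smul]
  gcongr
  · exact BL.norm_apply_le f t
  · exact BL.norm_apply_le _ t

lemma rinner_scalarAct (f : C₀(HalfLine, ℂ)) (η ξ : E) :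
    rinner (BL B) η (scalarAct B f ξ) = BL.scalarMul f (rinner (BL B) η ξ) := by
  have h1 := ((continuous_rinner_right (B := B) η).tendsto _).comp (tendsto_scalarAct (B := B) f ξ)
  have h2 := ((continuous_scalarMul f).tendsto _).comp
    ((CStarAlgebra.increasingApproximateUnit (BL B)).tendsto_mul_left (rinner (BL B) η ξ))
  refine tendsto_nhds_unique h1 (h2.congr fun u => ?_)
  ext t
  simp only [Function.comp, rinner_smul_right, BL.scalarMul_apply,
    ZeroAtInftyContinuousMap.mul_apply]
  exact (mul_smul_comm _ _ _).symm

lemma scalarAct_add (f : C₀(HalfLine, ℂ)) (ξ η : E) :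
    scalarAct B f (ξ + η) = scalarAct B f ξ + scalarAct B f η :=
  ext_rinner (BL B) fun ζ => by
    ext t; simp [rinner_scalarAct, rinner_add_right]

lemma scalarAct_smul (f : C₀(HalfLine, ℂ)) (c : ℂ) (ξ : E) :
    scalarAct B f (c • ξ) = c • scalarAct B f ξ :=
  ext_rinner (BL B) fun ζ => by
    ext t
    simp only [rinner_scalarAct, rinner_csmul_right, BL.scalarMul_apply,
      ZeroAtInftyContinuousMap.smul_apply]
    exact smul_comm _ _ _

variable (B E) in
/-- The action of `f ∈ C₀(L)` on `E`, as a bounded operator. -/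
def scalarCLM (f : C₀(HalfLine, ℂ)) : E →L[ℂ] E :=
  LinearMap.mkContinuous
    { toFun := scalarAct B f
      map_add' := scalarAct_add f
      map_smul' := scalarAct_smul f } ‖f‖ (norm_scalarAct_le f)

/-- The action of `f ∈ C₀(L)` on `E`, as an adjointable operator. -/
def scalarOp (f : C₀(HalfLine, ℂ)) : Adj (BL B) E :=
  Adj.mk (scalarCLM B E f) (scalarCLM B E (star f)) fun ξ η => by
    change rinner (BL B) (scalarAct B f ξ) η = rinner (BL B) ξ (scalarAct B (star f) η)
    rw [← star_rinner, rinner_scalarAct, rinner_scalarAct, ← star_rinner (BL B) ξ η]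
    ext t
    simp

@[simp] lemma scalarOp_apply (f : C₀(HalfLine, ℂ)) (ξ : E) :
    (scalarOp f : Adj (BL B) E).1 ξ = scalarAct B f ξ := rfl

/-- `T ∈ 𝓒(E)`, the ideal of locally compact-valued families: `T f` is compact for all
`f ∈ C₀(L)`. -/
def IsLocallyCompactValued (T : Adj (BL B) E) : Prop :=
  ∀ f : C₀(HalfLine, ℂ), T * scalarOp f ∈ compacts (BL B) E

variable (B) in
/-- The seminorm on `E` given by the norm `‖ξ_t‖ = ‖⟨ξ, ξ⟩(t)‖ ^ (1/2)` of the fibre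
`E_t = E ⊗_{ev_t} B`. Here `E → E_t`, `ξ ↦ ξ_t`, is the canonical surjection, so that `E_t` is the
quotient of `E` by the null space of this seminorm. -/
def fiberSeminorm (t : HalfLine) (ξ : E) : ℝ := √‖rinner (BL B) ξ ξ t‖

/-- `T ∈ 𝓙(E)`, the ideal of vanishing families: `‖T_t‖ → 0` as `t → ∞`, where `T_t` is the operator
`ξ_t ↦ (T ξ)_t` induced by `T` on the fibre `E_t`. -/
def IsVanishing (T : Adj (BL B) E) : Prop :=
  ∀ ε > 0, ∀ᶠ t : HalfLine in atTop, ∀ ξ : E,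
    fiberSeminorm B t (T.1 ξ) ≤ ε * fiberSeminorm B t ξ

/-- `T ≥ 0` modulo `𝓒(E) + 𝓙(E)`: up to an element of `𝓒(E) + 𝓙(E)`, the operator `T` is a positive
element `P⋆ P` of the `C⋆`-algebra of adjointable operators. -/
def IsNonnegModulo (T : Adj (BL B) E) : Prop :=
  ∃ P K J : Adj (BL B) E, IsLocallyCompactValued K ∧ IsVanishing J ∧ T = star P * P + (K + J)

end BLModule

/-! ### Direct sums of operators -/

section DirectSum

variable (D : Type*) {E E' : Type*} [NonUnitalCStarAlgebra D] [PartialOrder D] [StarOrderedRing D]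
  [NormedAddCommGroup E] [NormedSpace ℂ E] [SMul Dᵐᵒᵖ E] [CStarModule Dᵐᵒᵖ E]
  [NormedAddCommGroup E'] [NormedSpace ℂ E'] [SMul Dᵐᵒᵖ E'] [CStarModule Dᵐᵒᵖ E']

variable (E E') in
/-- The direct sum `E ⊕ E'` of Hilbert `D`-modules, with
`⟨(ξ, ξ'), (η, η')⟩ = ⟨ξ, η⟩ + ⟨ξ', η'⟩`. -/
abbrev DSum : Type _ := C⋆ᵐᵒᵈ(Dᵐᵒᵖ, E × E')

/-- The vector `(ξ, ξ')` of `E ⊕ E'`. -/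
def dpair (ξ : E) (ξ' : E') : DSum D E E' := (WithCStarModule.equiv Dᵐᵒᵖ (E × E')).symm (ξ, ξ')

variable {D}

@[simp] lemma dpair_fst (ξ : E) (ξ' : E') : (dpair D ξ ξ').fst = ξ := rfl
@[simp] lemma dpair_snd (ξ : E) (ξ' : E') : (dpair D ξ ξ').snd = ξ' := rfl

lemma dsum_ext {x y : DSum D E E'} (h1 : x.fst = y.fst) (h2 : x.snd = y.snd) : x = y :=
  Prod.ext h1 h2

lemma rinner_dsum (x y : DSum D E E') :
    rinner D x y = rinner D x.fst y.fst + rinner D x.snd y.snd := rfl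

lemma dsum_smul_fst (x : DSum D E E') (d : D) : (x <• d).fst = x.fst <• d := rfl
lemma dsum_smul_snd (x : DSum D E E') (d : D) : (x <• d).snd = x.snd <• d := rfl

/-- The direct sum `T ⊕ T'` of two bounded operators. -/
def clmDSum (T : E →L[ℂ] E) (T' : E' →L[ℂ] E') : DSum D E E' →L[ℂ] DSum D E E' :=
  ((WithCStarModule.equivL ℂ (A := Dᵐᵒᵖ) (E := E × E')).symm : E × E' →L[ℂ] DSum D E E') ∘L
    (T.prodMap T') ∘L
    ((WithCStarModule.equivL ℂ (A := Dᵐᵒᵖ) (E := E × E')) : DSum D E E' →L[ℂ] E × E')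

@[simp] lemma clmDSum_fst (T : E →L[ℂ] E) (T' : E' →L[ℂ] E') (x : DSum D E E') :
    (clmDSum T T' x).fst = T x.fst := rfl
@[simp] lemma clmDSum_snd (T : E →L[ℂ] E) (T' : E' →L[ℂ] E') (x : DSum D E E') :
    (clmDSum T T' x).snd = T' x.snd := rfl

/-- The direct sum `T ⊕ T'` of two adjointable operators. -/
def adjDSum (T : Adj D E) (T' : Adj D E') : Adj D (DSum D E E') :=
  Adj.mk (clmDSum T.1 T'.1) (clmDSum (star T).1 (star T').1) fun x y => by
    simp [rinner_dsum, rinner_apply_left]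

@[simp] lemma adjDSum_fst (T : Adj D E) (T' : Adj D E') (x : DSum D E E') :
    ((adjDSum T T').1 x).fst = T.1 x.fst := rfl
@[simp] lemma adjDSum_snd (T : Adj D E) (T' : Adj D E') (x : DSum D E E') :
    ((adjDSum T T').1 x).snd = T'.1 x.snd := rfl

lemma adj_dsum_ext {T S : Adj D (DSum D E E')}
    (h1 : ∀ x, (T.1 x).fst = (S.1 x).fst) (h2 : ∀ x, (T.1 x).snd = (S.1 x).snd) : T = S :=
  Subtype.ext <| ContinuousLinearMap.ext fun x => dsum_ext (h1 x) (h2 x)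

lemma adjDSum_mul (T S : Adj D E) (T' S' : Adj D E') :
    adjDSum (T * S) (T' * S') = adjDSum T T' * adjDSum S S' :=
  adj_dsum_ext (fun _ => rfl) (fun _ => rfl)

lemma adjDSum_add (T S : Adj D E) (T' S' : Adj D E') :
    adjDSum (T + S) (T' + S') = adjDSum T T' + adjDSum S S' :=
  adj_dsum_ext (fun _ => rfl) (fun _ => rfl)

lemma adjDSum_sub (T S : Adj D E) (T' S' : Adj D E') :
    adjDSum (T - S) (T' - S') = adjDSum T T' - adjDSum S S' :=
  adj_dsum_ext (fun _ => rfl) (fun _ => rfl)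

lemma adjDSum_smul (c : ℂ) (T : Adj D E) (T' : Adj D E') :
    adjDSum (c • T) (c • T') = c • adjDSum T T' :=
  adj_dsum_ext (fun _ => rfl) (fun _ => rfl)

lemma adjDSum_zero : adjDSum (0 : Adj D E) (0 : Adj D E') = 0 :=
  adj_dsum_ext (fun _ => rfl) (fun _ => rfl)

lemma adjDSum_one : adjDSum (1 : Adj D E) (1 : Adj D E') = 1 :=
  adj_dsum_ext (fun _ => rfl) (fun _ => rfl)

lemma adjDSum_star (T : Adj D E) (T' : Adj D E') :
    adjDSum (star T) (star T') = star (adjDSum T T') :=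
  eq_star_of_rinner fun x y => by
    rw [rinner_dsum, rinner_dsum]
    simp only [adjDSum_fst, adjDSum_snd, rinner_apply_left]

lemma norm_adjDSum_le (T : Adj D E) (T' : Adj D E') : ‖adjDSum T T'‖ ≤ ‖T‖ + ‖T'‖ := by
  refine ContinuousLinearMap.opNorm_le_bound _ (by positivity) fun x => ?_
  refine (WithCStarModule.prod_norm_le_norm_add _).trans ?_
  have h := (WithCStarModule.max_le_prod_norm x)
  have h1 : ‖x.fst‖ ≤ ‖x‖ := (le_max_left _ _).trans h
  have h2 : ‖x.snd‖ ≤ ‖x‖ := (le_max_right _ _).trans h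
  have h3 : ‖T.1 x.fst‖ ≤ ‖T‖ * ‖x‖ := (T.1.le_opNorm _).trans (by
    change ‖T.1‖ * _ ≤ ‖T.1‖ * _; gcongr)
  have h4 : ‖T'.1 x.snd‖ ≤ ‖T'‖ * ‖x‖ := (T'.1.le_opNorm _).trans (by
    change ‖T'.1‖ * _ ≤ ‖T'.1‖ * _; gcongr)
  change ‖T.1 x.fst‖ + ‖T'.1 x.snd‖ ≤ _
  linarith

lemma continuous_adjDSum {X : Type*} [TopologicalSpace X] {f : X → Adj D E} {f' : X → Adj D E'}
    (hf : Continuous f) (hf' : Continuous f') : Continuous fun x => adjDSum (f x) (f' x) := by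
  refine continuous_iff_continuousAt.2 fun x₀ => ?_
  rw [ContinuousAt, tendsto_iff_norm_sub_tendsto_zero]
  have h : Tendsto (fun x => ‖f x - f x₀‖ + ‖f' x - f' x₀‖) (𝓝 x₀) (𝓝 0) := by
    have hc : Continuous fun x => ‖f x - f x₀‖ + ‖f' x - f' x₀‖ := by fun_prop
    have h0 := hc.tendsto x₀
    simpa using h0
  refine squeeze_zero (fun _ => norm_nonneg _) (fun x => ?_) h
  rw [← adjDSum_sub]
  exact norm_adjDSum_le _ _

lemma adjDSum_mem_compacts {T : Adj D E} {T' : Adj D E'} (h : T ∈ compacts D E)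
    (h' : T' ∈ compacts D E') : adjDSum T T' ∈ compacts D (DSum D E E') := by
  have key1 : ∀ S ∈ compacts D E, adjDSum S (0 : Adj D E') ∈ compacts D (DSum D E E') := by
    intro S hS
    have hc : Continuous fun S : Adj D E => adjDSum S (0 : Adj D E') :=
      continuous_adjDSum continuous_id continuous_const
    refine map_mem_closure (f := fun S => adjDSum S (0 : Adj D E')) hc hS fun R hR => ?_
    change adjDSum R (0 : Adj D E') ∈ Submodule.span ℂ _
    induction hR using Submodule.span_induction with
    | mem R hR =>
      obtain ⟨ξ, η, hR⟩ := hR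
      refine Submodule.subset_span ⟨dpair D ξ 0, dpair D η 0, fun ζ => dsum_ext ?_ ?_⟩
      · simp [hR, rinner_dsum, rinner_zero_left]
      · exact ext_rinner D fun x => by
          simp [rinner_smul_right, rinner_zero_right]
    | zero => rw [adjDSum_zero]; exact Submodule.zero_mem _
    | add R S _ _ h1 h2 =>
      have := Submodule.add_mem _ h1 h2
      rwa [← adjDSum_add, add_zero] at this
    | smul c R _ h1 =>
      have := Submodule.smul_mem _ c h1
      rwa [← adjDSum_smul, smul_zero] at this
  have key2 : ∀ S ∈ compacts D E', adjDSum (0 : Adj D E) S ∈ compacts D (DSum D E E') := by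
    intro S hS
    have hc : Continuous fun S : Adj D E' => adjDSum (0 : Adj D E) S :=
      continuous_adjDSum continuous_const continuous_id
    refine map_mem_closure hc hS fun R hR => ?_
    change adjDSum (0 : Adj D E) R ∈ Submodule.span ℂ _
    induction hR using Submodule.span_induction with
    | mem R hR =>
      obtain ⟨ξ, η, hR⟩ := hR
      refine Submodule.subset_span ⟨dpair D 0 ξ, dpair D 0 η, fun ζ => dsum_ext ?_ ?_⟩
      · exact ext_rinner D fun x => by
          simp [rinner_smul_right, rinner_zero_right]
      · simp [hR, rinner_dsum, rinner_zero_left]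
    | zero => rw [adjDSum_zero]; exact Submodule.zero_mem _
    | add R S _ _ h1 h2 =>
      have := Submodule.add_mem _ h1 h2
      rwa [← adjDSum_add, add_zero] at this
    | smul c R _ h1 =>
      have := Submodule.smul_mem _ c h1
      rwa [← adjDSum_smul, smul_zero] at this
  have := Submodule.add_mem _ (key1 T h) (key2 T' h')
  rwa [← adjDSum_add, add_zero, zero_add] at this

lemma dense_dsum_span {S : Set E} {S' : Set E'}
    (hS : Dense (Submodule.span ℂ {ζ : E | ∃ ξ ∈ S, ∃ d : D, ζ = ξ <• d} : Set E))
    (hS' : Dense (Submodule.span ℂ {ζ : E' | ∃ ξ ∈ S', ∃ d : D, ζ = ξ <• d} : Set E')) :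
    Dense (Submodule.span ℂ {ζ : DSum D E E' |
      ∃ ξ ∈ (fun ξ => dpair D ξ (0 : E')) '' S ∪ (fun ξ' => dpair D (0 : E) ξ') '' S', ∃ d : D,
        ζ = ξ <• d} : Set (DSum D E E')) := by
  set V := Submodule.span ℂ {ζ : DSum D E E' |
      ∃ ξ ∈ (fun ξ => dpair D ξ (0 : E')) '' S ∪ (fun ξ' => dpair D (0 : E) ξ') '' S', ∃ d : D,
        ζ = ξ <• d} with hV
  let e := (WithCStarModule.equivL ℂ (A := Dᵐᵒᵖ) (E := E × E')).symm
  let i : E →L[ℂ] DSum D E E' := (e : E × E' →L[ℂ] DSum D E E') ∘L ContinuousLinearMap.inl ℂ E E'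
  let i' : E' →L[ℂ] DSum D E E' := (e : E × E' →L[ℂ] DSum D E E') ∘L ContinuousLinearMap.inr ℂ E E'
  have h0 : ∀ d : D, (0 : E) <• d = 0 := fun d => ext_rinner D fun x => by
    simp [rinner_smul_right, rinner_zero_right]
  have h0' : ∀ d : D, (0 : E') <• d = 0 := fun d => ext_rinner D fun x => by
    simp [rinner_smul_right, rinner_zero_right]
  have h1 : ∀ ξ, i ξ ∈ V.topologicalClosure := fun ξ => by
    refine map_mem_closure i.continuous (hS ξ) fun ζ hζ => ?_
    have : Submodule.span ℂ {ζ : E | ∃ ξ ∈ S, ∃ d : D, ζ = ξ <• d} ≤ V.comap i.toLinearMap := by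
      refine Submodule.span_le.2 ?_
      rintro _ ⟨ξ, hξ, d, rfl⟩
      exact Submodule.subset_span ⟨dpair D ξ 0, Or.inl ⟨ξ, hξ, rfl⟩, d,
        dsum_ext rfl (h0' d).symm⟩
    exact this hζ
  have h2 : ∀ ξ, i' ξ ∈ V.topologicalClosure := fun ξ => by
    refine map_mem_closure i'.continuous (hS' ξ) fun ζ hζ => ?_
    have : Submodule.span ℂ {ζ : E' | ∃ ξ ∈ S', ∃ d : D, ζ = ξ <• d} ≤ V.comap i'.toLinearMap := by
      refine Submodule.span_le.2 ?_
      rintro _ ⟨ξ, hξ, d, rfl⟩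
      exact Submodule.subset_span ⟨dpair D 0 ξ, Or.inr ⟨ξ, hξ, rfl⟩, d,
        dsum_ext (h0 d).symm rfl⟩
    exact this hζ
  intro x
  have h3 := Submodule.add_mem _ (h1 x.fst) (h2 x.snd)
  have h4 : i x.fst + i' x.snd = x := by
    refine dsum_ext ?_ ?_
    · change x.fst + 0 = x.fst; simp
    · change 0 + x.snd = x.snd; simp
  rw [h4] at h3
  exact h3

end DirectSum

section BLDirectSum

variable {B E E' : Type*} [NonUnitalCStarAlgebra B]
  [NormedAddCommGroup E] [NormedSpace ℂ E] [SMul (BL B)ᵐᵒᵖ E] [CStarModule (BL B)ᵐᵒᵖ E]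
  [NormedAddCommGroup E'] [NormedSpace ℂ E'] [SMul (BL B)ᵐᵒᵖ E'] [CStarModule (BL B)ᵐᵒᵖ E']

lemma fiberSeminorm_sq (t : HalfLine) (ξ : E) :
    fiberSeminorm B t ξ ^ 2 = ‖rinner (BL B) ξ ξ t‖ := Real.sq_sqrt (norm_nonneg _)

lemma fiberSeminorm_nonneg (t : HalfLine) (ξ : E) : 0 ≤ fiberSeminorm B t ξ := Real.sqrt_nonneg _

/-- The value at `t` of a nonnegative element of `BL` is of the form `z⋆ z`. -/
lemma exists_star_mul_self_of_nonneg {b : BL B} (hb : 0 ≤ b) (t : HalfLine) :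
    ∃ z : B, b t = star z * z := by
  obtain ⟨c, rfl⟩ := CStarAlgebra.nonneg_iff_eq_star_mul_self.1 hb
  exact ⟨c t, rfl⟩

lemma norm_apply_le_norm_add_apply {b c : BL B} (hb : 0 ≤ b) (hc : 0 ≤ c) (t : HalfLine) :
    ‖b t‖ ≤ ‖b t + c t‖ := by
  let _ : PartialOrder B := CStarAlgebra.spectralOrder B
  have _ : StarOrderedRing B := CStarAlgebra.spectralOrderedRing B
  obtain ⟨z, hz⟩ := exists_star_mul_self_of_nonneg hb t
  obtain ⟨w, hw⟩ := exists_star_mul_self_of_nonneg hc t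
  refine CStarAlgebra.norm_le_norm_of_nonneg_of_le ?_ ?_
  · rw [hz]; exact star_mul_self_nonneg z
  · rw [hw]; exact le_add_of_nonneg_right (star_mul_self_nonneg w)

lemma fiberSeminorm_fst_le (t : HalfLine) (x : DSum (BL B) E E') :
    fiberSeminorm B t x.fst ≤ fiberSeminorm B t x := by
  refine Real.sqrt_le_sqrt ?_
  exact norm_apply_le_norm_add_apply (rinner_self_nonneg _ _) (rinner_self_nonneg _ _) t

lemma fiberSeminorm_snd_le (t : HalfLine) (x : DSum (BL B) E E') :
    fiberSeminorm B t x.snd ≤ fiberSeminorm B t x := by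
  refine Real.sqrt_le_sqrt ?_
  rw [rinner_dsum, add_comm]
  exact norm_apply_le_norm_add_apply (rinner_self_nonneg _ _) (rinner_self_nonneg _ _) t

lemma fiberSeminorm_le_add (t : HalfLine) (x : DSum (BL B) E E') :
    fiberSeminorm B t x ≤ fiberSeminorm B t x.fst + fiberSeminorm B t x.snd := by
  refine le_of_sq_le_sq ?_ (add_nonneg (fiberSeminorm_nonneg _ _) (fiberSeminorm_nonneg _ _))
  have h1 := fiberSeminorm_nonneg (B := B) t x.fst
  have h2 := fiberSeminorm_nonneg (B := B) t x.snd
  calc fiberSeminorm B t x ^ 2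
      = ‖rinner (BL B) x.fst x.fst t + rinner (BL B) x.snd x.snd t‖ := fiberSeminorm_sq t x
    _ ≤ fiberSeminorm B t x.fst ^ 2 + fiberSeminorm B t x.snd ^ 2 := by
        rw [fiberSeminorm_sq, fiberSeminorm_sq]; exact norm_add_le _ _
    _ ≤ _ := by nlinarith

variable [CompleteSpace E] [CompleteSpace E']

lemma IsVanishing.dsum {T : Adj (BL B) E} {T' : Adj (BL B) E'} (h : IsVanishing T)
    (h' : IsVanishing T') : IsVanishing (adjDSum T T') := by
  intro ε hε
  filter_upwards [h (ε / 2) (half_pos hε), h' (ε / 2) (half_pos hε)] with t h1 h2 x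
  have h3 := fiberSeminorm_le_add t ((adjDSum T T').1 x)
  have h4 := h1 x.fst
  have h5 := h2 x.snd
  have h6 := mul_le_mul_of_nonneg_left (fiberSeminorm_fst_le t x) (half_pos hε).le
  have h7 := mul_le_mul_of_nonneg_left (fiberSeminorm_snd_le t x) (half_pos hε).le
  rw [adjDSum_fst, adjDSum_snd] at h3
  linarith

lemma scalarOp_dsum (f : C₀(HalfLine, ℂ)) :
    (scalarOp f : Adj (BL B) (DSum (BL B) E E')) = adjDSum (scalarOp f) (scalarOp f) := by
  refine adj_ext fun x y => ?_
  rw [scalarOp_apply, rinner_scalarAct, rinner_dsum, rinner_dsum]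
  rw [adjDSum_fst, adjDSum_snd, scalarOp_apply, scalarOp_apply, rinner_scalarAct,
    rinner_scalarAct]
  ext t
  simp

lemma IsLocallyCompactValued.dsum {T : Adj (BL B) E} {T' : Adj (BL B) E'}
    (h : IsLocallyCompactValued T) (h' : IsLocallyCompactValued T') :
    IsLocallyCompactValued (adjDSum T T') := by
  intro f
  rw [scalarOp_dsum, ← adjDSum_mul]
  exact adjDSum_mem_compacts (h f) (h' f)

lemma IsNonnegModulo.dsum {T : Adj (BL B) E} {T' : Adj (BL B) E'} (h : IsNonnegModulo T)
    (h' : IsNonnegModulo T') : IsNonnegModulo (adjDSum T T') := by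
  obtain ⟨P, K, J, hK, hJ, rfl⟩ := h
  obtain ⟨P', K', J', hK', hJ', rfl⟩ := h'
  exact ⟨adjDSum P P', adjDSum K K', adjDSum J J', hK.dsum hK', hJ.dsum hJ', by
    rw [adjDSum_add, adjDSum_add, adjDSum_mul, adjDSum_star]⟩

end BLDirectSum

/-! ### Continuous fields of modules and asymptotic Kasparov modules -/

universe uG uA uB

/-- A continuous field of `G`-`(A, B)`-modules: a countably generated, graded Hilbert `BL`-module `E`
with a continuous action of `G` and a left action of `A` through an equivariant (and grading
preserving) `⋆`-homomorphism `φ` into the adjointable operators. The grading is given by the grading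
operator `grade`, with `grade ξ = (-1) ^ ∂ξ • ξ` for homogeneous `ξ`. -/
structure ContinuousField (G : Type uG) (A : Type uA) (B : Type uB)
    [Group G] [TopologicalSpace G] [NonUnitalCStarAlgebra A] [NonUnitalCStarAlgebra B]
    [GradedGCStarAlgebra G A] [GradedGCStarAlgebra G B] where
  E : Type uB
  [instNormedAddCommGroup : NormedAddCommGroup E]
  [instNormedSpace : NormedSpace ℂ E]
  [instSMul : SMul (BL B)ᵐᵒᵖ E]
  [instCStarModule : CStarModule (BL B)ᵐᵒᵖ E]
  [instCompleteSpace : CompleteSpace E]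
  countablyGenerated : CountablyGenerated (BL B) E
  grade : E →ₗ[ℂ] E
  grade_grade : ∀ ξ, grade (grade ξ) = ξ
  grade_smul : ∀ (ξ : E) (b : BL B), grade (ξ <• b) = grade ξ <• BL.grade G b
  rinner_grade : ∀ ξ η, rinner (BL B) (grade ξ) (grade η) = BL.grade G (rinner (BL B) ξ η)
  gact : G → E →ₗ[ℂ] E
  gact_one : ∀ ξ, gact 1 ξ = ξ
  gact_mul : ∀ g h ξ, gact (g * h) ξ = gact g (gact h ξ)
  continuous_gact : Continuous fun p : G × E => gact p.1 p.2
  gact_smul : ∀ g (ξ : E) (b : BL B), gact g (ξ <• b) = gact g ξ <• BL.act g b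
  rinner_gact : ∀ g ξ η, rinner (BL B) (gact g ξ) (gact g η) = BL.act g (rinner (BL B) ξ η)
  grade_gact : ∀ g ξ, grade (gact g ξ) = gact g (grade ξ)
  φ : A →⋆ₙₐ[ℂ] Adj (BL B) E
  gact_φ : ∀ g a ξ, gact g ((φ a).1 ξ) = (φ (GradedGCStarAlgebra.act g a)).1 (gact g ξ)
  grade_φ : ∀ a ξ, grade ((φ a).1 ξ) = (φ (GradedGCStarAlgebra.grade G a)).1 (grade ξ)

attribute [instance] ContinuousField.instNormedAddCommGroup ContinuousField.instNormedSpace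
  ContinuousField.instSMul ContinuousField.instCStarModule ContinuousField.instCompleteSpace

section Fields

variable {G : Type uG} {A : Type uA} {B : Type uB} [Group G] [TopologicalSpace G]
  [NonUnitalCStarAlgebra A] [NonUnitalCStarAlgebra B]
  [GradedGCStarAlgebra G A] [GradedGCStarAlgebra G B]

namespace ContinuousField

/-- The action of `g` on `E`, as a bounded operator. -/
def gactL (M : ContinuousField G A B) (g : G) : M.E →L[ℂ] M.E :=
  ⟨M.gact g, M.continuous_gact.comp (continuous_const.prodMk continuous_id)⟩

@[simp] lemma gactL_apply (M : ContinuousField G A B) (g : G) (ξ : M.E) :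
    M.gactL g ξ = M.gact g ξ := rfl

lemma rinner_gact_left (M : ContinuousField G A B) (g : G) (ξ η : M.E) :
    rinner (BL B) (M.gact g ξ) η = BL.act g (rinner (BL B) ξ (M.gact g⁻¹ η)) := by
  rw [← M.rinner_gact, ← M.gact_mul, mul_inv_cancel, M.gact_one]

lemma rinner_gact_right (M : ContinuousField G A B) (g : G) (ξ η : M.E) :
    rinner (BL B) ξ (M.gact g η) = BL.act g (rinner (BL B) (M.gact g⁻¹ ξ) η) := by
  rw [← M.rinner_gact, ← M.gact_mul, mul_inv_cancel, M.gact_one]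

/-- The induced action of `G` on adjointable operators: `g(T) ξ = g(T(g⁻¹ ξ))`. -/
def conj (M : ContinuousField G A B) (g : G) (T : Adj (BL B) M.E) : Adj (BL B) M.E :=
  Adj.mk (M.gactL g ∘L T.1 ∘L M.gactL g⁻¹) (M.gactL g ∘L (star T).1 ∘L M.gactL g⁻¹) fun ξ η => by
    change rinner (BL B) (M.gact g (T.1 (M.gact g⁻¹ ξ))) η
      = rinner (BL B) ξ (M.gact g ((star T).1 (M.gact g⁻¹ η)))
    rw [rinner_gact_left, rinner_apply_left, rinner_gact_right M g ξ]

@[simp] lemma conj_apply (M : ContinuousField G A B) (g : G) (T : Adj (BL B) M.E) (ξ : M.E) :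
    (M.conj g T).1 ξ = M.gact g (T.1 (M.gact g⁻¹ ξ)) := rfl

end ContinuousField

variable (G A B) in
/-- An asymptotic Kasparov `G`-`(A, B)`-module `(E, F)`, i.e. an element of `ke_G(A, B)`. In `akm2`,
`F φ(a) - φ(grade a) F` is the graded commutator `[F, φ(a)]`, since `F` is odd. -/
structure AsymptoticKasparovModule extends ContinuousField G A B where
  F : Adj (BL B) E
  odd_F : ∀ ξ, grade (F.1 ξ) = -F.1 (grade ξ)
  continuous_F : Continuous fun g => toContinuousField.conj g F
  akm1 : ∀ a, IsVanishing ((F - star F) * φ a)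
  akm2 : ∀ a, IsVanishing (F * φ a - φ (GradedGCStarAlgebra.grade G a) * F)
  akm3 : ∀ a, IsNonnegModulo (φ a * (F * F - 1) * star (φ a))
  akm4 : ∀ g a, IsVanishing ((toContinuousField.conj g F - F) * φ a)

namespace ContinuousField

/-- The direct sum of two continuous fields of modules. -/
def directSum (M N : ContinuousField G A B) : ContinuousField G A B where
  E := DSum (BL B) M.E N.E
  countablyGenerated := by
    obtain ⟨S, hS, hSd⟩ := M.countablyGenerated
    obtain ⟨S', hS', hSd'⟩ := N.countablyGenerated
    exact ⟨_, (hS.image _).union (hS'.image _), dense_dsum_span hSd hSd'⟩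
  grade :=
    { toFun := fun x => dpair (BL B) (M.grade x.fst) (N.grade x.snd)
      map_add' := fun x y => dsum_ext (map_add M.grade _ _) (map_add N.grade _ _)
      map_smul' := fun c x => dsum_ext (map_smul M.grade _ _) (map_smul N.grade _ _) }
  grade_grade x := dsum_ext (M.grade_grade _) (N.grade_grade _)
  grade_smul x b := dsum_ext (M.grade_smul _ _) (N.grade_smul _ _)
  rinner_grade x y := by
    rw [rinner_dsum, rinner_dsum, map_add, ← M.rinner_grade, ← N.rinner_grade]; rfl
  gact g :=
    { toFun := fun x => dpair (BL B) (M.gact g x.fst) (N.gact g x.snd)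
      map_add' := fun x y => dsum_ext (map_add (M.gact g) _ _) (map_add (N.gact g) _ _)
      map_smul' := fun c x => dsum_ext (map_smul (M.gact g) _ _) (map_smul (N.gact g) _ _) }
  gact_one x := dsum_ext (M.gact_one _) (N.gact_one _)
  gact_mul g h x := dsum_ext (M.gact_mul _ _ _) (N.gact_mul _ _ _)
  continuous_gact := by
    let e := WithCStarModule.equivL ℂ (A := (BL B)ᵐᵒᵖ) (E := M.E × N.E)
    have he : Continuous fun p : G × DSum (BL B) M.E N.E => e p.2 := e.continuous.comp continuous_snd
    have h1 : Continuous fun p : G × DSum (BL B) M.E N.E => M.gact p.1 (e p.2).1 :=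
      M.continuous_gact.comp (continuous_fst.prodMk (continuous_fst.comp he))
    have h2 : Continuous fun p : G × DSum (BL B) M.E N.E => N.gact p.1 (e p.2).2 :=
      N.continuous_gact.comp (continuous_fst.prodMk (continuous_snd.comp he))
    exact e.symm.continuous.comp (h1.prodMk h2)
  gact_smul g x b := dsum_ext (M.gact_smul _ _ _) (N.gact_smul _ _ _)
  rinner_gact g x y := by
    rw [rinner_dsum, rinner_dsum, map_add, ← M.rinner_gact, ← N.rinner_gact]; rfl
  grade_gact g x := dsum_ext (M.grade_gact _ _) (N.grade_gact _ _)
  φ :=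
    { toFun := fun a => adjDSum (M.φ a) (N.φ a)
      map_smul' := fun c a => by
        rw [map_smul, map_smul]; exact adjDSum_smul _ _ _
      map_zero' := by rw [map_zero, map_zero]; exact adjDSum_zero
      map_add' := fun a b => by rw [map_add, map_add]; exact adjDSum_add _ _ _ _
      map_mul' := fun a b => by rw [map_mul, map_mul]; exact adjDSum_mul _ _ _ _
      map_star' := fun a => by rw [map_star, map_star]; exact adjDSum_star _ _ }
  gact_φ g a x := dsum_ext (M.gact_φ _ _ _) (N.gact_φ _ _ _)
  grade_φ a x := dsum_ext (M.grade_φ _ _) (N.grade_φ _ _)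

lemma conj_directSum (M N : ContinuousField G A B) (g : G) (T : Adj (BL B) M.E)
    (S : Adj (BL B) N.E) :
    (M.directSum N).conj g (adjDSum T S) = adjDSum (M.conj g T) (N.conj g S) := rfl

/-- The module `E^op`: the Hilbert module `E` with the opposite grading and the same action of `G`,
where `a ∈ A` acts as `(-1) ^ ∂a • a`. -/
def opposite (M : ContinuousField G A B) : ContinuousField G A B where
  E := M.E
  countablyGenerated := M.countablyGenerated
  grade := -M.grade
  grade_grade ξ := by simp [M.grade_grade]
  grade_smul ξ b := by
    rw [LinearMap.neg_apply, LinearMap.neg_apply, M.grade_smul]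
    exact ext_rinner (BL B) fun ζ => by
      rw [rinner_neg_right, rinner_smul_right, rinner_smul_right, rinner_neg_right, neg_mul]
  rinner_grade ξ η := by
    simp only [LinearMap.neg_apply, rinner_neg_left, rinner_neg_right, neg_neg, M.rinner_grade]
  gact := M.gact
  gact_one := M.gact_one
  gact_mul := M.gact_mul
  continuous_gact := M.continuous_gact
  gact_smul := M.gact_smul
  rinner_gact := M.rinner_gact
  grade_gact g ξ := by simp [M.grade_gact]
  φ := M.φ.comp (GradedGCStarAlgebra.grade G)
  gact_φ g a ξ := by
    simp only [NonUnitalStarAlgHom.comp_apply, GradedGCStarAlgebra.grade_act]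
    exact M.gact_φ _ _ _
  grade_φ a ξ := by
    simp only [NonUnitalStarAlgHom.comp_apply, LinearMap.neg_apply, map_neg, M.grade_φ]

end ContinuousField

lemma IsVanishing.neg {E : Type*} [NormedAddCommGroup E] [NormedSpace ℂ E] [SMul (BL B)ᵐᵒᵖ E]
    [CStarModule (BL B)ᵐᵒᵖ E] [CompleteSpace E] {T : Adj (BL B) E} (h : IsVanishing T) :
    IsVanishing (-T) := by
  intro ε hε
  filter_upwards [h ε hε] with t ht ξ
  have h1 : fiberSeminorm B t ((-T).1 ξ) = fiberSeminorm B t (T.1 ξ) := by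
    change √‖rinner (BL B) (-(T.1 ξ)) (-(T.1 ξ)) t‖ = _
    rw [rinner_neg_left, rinner_neg_right, neg_neg]
    rfl
  rw [h1]
  exact ht ξ

namespace AsymptoticKasparovModule

/-- The sum `(E₁, F₁) + (E₂, F₂) = (E₁ ⊕ E₂, F₁ ⊕ F₂)` of asymptotic Kasparov modules. -/
def directSum (X Y : AsymptoticKasparovModule G A B) : AsymptoticKasparovModule G A B where
  toContinuousField := X.toContinuousField.directSum Y.toContinuousField
  F := adjDSum X.F Y.F
  odd_F x := dsum_ext (D := BL B) (X.odd_F x.fst) (Y.odd_F x.snd)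
  continuous_F := continuous_adjDSum (D := BL B) (E := X.E) (E' := Y.E) X.continuous_F Y.continuous_F
  akm1 a := by
    have h := (X.akm1 a).dsum (Y.akm1 a)
    rw [adjDSum_mul, adjDSum_sub, adjDSum_star] at h
    exact h
  akm2 a := by
    have h := (X.akm2 a).dsum (Y.akm2 a)
    rw [adjDSum_sub, adjDSum_mul, adjDSum_mul] at h
    exact h
  akm3 a := by
    have h := (X.akm3 a).dsum (Y.akm3 a)
    rw [adjDSum_mul, adjDSum_mul, adjDSum_sub, adjDSum_mul, adjDSum_one, adjDSum_star] at h
    exact h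
  akm4 g a := by
    have h := (X.akm4 g a).dsum (Y.akm4 g a)
    rw [adjDSum_mul, adjDSum_sub] at h
    exact h

/-- The asymptotic Kasparov module `(E^op, -F)`. -/
def opposite (X : AsymptoticKasparovModule G A B) : AsymptoticKasparovModule G A B where
  toContinuousField := X.toContinuousField.opposite
  F := (-X.F : Adj (BL B) X.E)
  odd_F ξ := by
    change -X.grade (-(X.F.1 ξ)) = -(-(X.F.1 (-X.grade ξ)))
    rw [map_neg, map_neg, neg_neg, neg_neg]
    exact X.odd_F ξ
  continuous_F := by
    have h : ∀ g, X.toContinuousField.conj g (-X.F) = -X.toContinuousField.conj g X.F := fun g =>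
      Subtype.ext <| ContinuousLinearMap.ext fun ξ => map_neg (X.gact g) _
    change Continuous fun g => X.toContinuousField.conj g (-X.F)
    simp_rw [h]
    exact X.continuous_F.neg
  akm1 a := by
    have h := (X.akm1 (GradedGCStarAlgebra.grade G a)).neg
    have e : -((X.F - star X.F) * X.φ (GradedGCStarAlgebra.grade G a))
        = (-X.F - star (-X.F)) * X.φ (GradedGCStarAlgebra.grade G a) := by
      rw [star_neg, ← neg_mul, neg_sub, neg_sub_neg]
    rw [e] at h
    exact h
  akm2 a := by
    have h := (X.akm2 (GradedGCStarAlgebra.grade G a)).neg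
    have e : -(X.F * X.φ (GradedGCStarAlgebra.grade G a) - X.φ (GradedGCStarAlgebra.grade G
          (GradedGCStarAlgebra.grade G a)) * X.F)
        = -X.F * X.φ (GradedGCStarAlgebra.grade G a) - X.φ (GradedGCStarAlgebra.grade G
          (GradedGCStarAlgebra.grade G a)) * -X.F := by
      rw [neg_mul, mul_neg, neg_sub, sub_neg_eq_add, neg_add_eq_sub]
    rw [e] at h
    exact h
  akm3 a := by
    have h := X.akm3 (GradedGCStarAlgebra.grade G a)
    rw [← neg_mul_neg X.F X.F] at h
    exact h
  akm4 g a := by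
    have h := (X.akm4 g (GradedGCStarAlgebra.grade G a)).neg
    have e : -((X.toContinuousField.conj g X.F - X.F) * X.φ (GradedGCStarAlgebra.grade G a))
        = (X.toContinuousField.conj g (-X.F) - -X.F) * X.φ (GradedGCStarAlgebra.grade G a) := by
      have h : X.toContinuousField.conj g (-X.F) = -X.toContinuousField.conj g X.F :=
        Subtype.ext <| ContinuousLinearMap.ext fun ξ => map_neg (X.gact g) _
      rw [h, ← neg_mul, neg_sub, neg_sub_neg]
    rw [e] at h
    exact h

/-- `X` is the evaluation `(E_s, F_s) = (W ⊗_{ev_s} BL, F ⊗_{ev_s} 1)` at `s ∈ [0,1]` of the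
asymptotic Kasparov `G`-`(A, B[0,1])`-module `W`, up to a unitary isomorphism. The Hilbert module of
`X` is the internal tensor product along `ev_s : B[0,1]L → BL`, that is, the completion of the
algebraic tensor product (`τ ξ b` is `ξ ⊗ b`) for the inner product
`⟨ξ ⊗ b, ξ' ⊗ b'⟩ = b⋆ ev_s(⟨ξ, ξ'⟩) b'`. -/
def IsEvaluation (s : I) (W : AsymptoticKasparovModule G A C(I, B))
    (X : AsymptoticKasparovModule G A B) : Prop :=
  ∃ τ : W.E →ₗ[ℂ] BL B →ₗ[ℂ] X.E,
    (∀ ξ ξ' b b', rinner (BL B) (τ ξ b) (τ ξ' b') =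
      star b * BL.map (evalAt B s) (rinner (BL C(I, B)) ξ ξ') * b') ∧
    Dense (Submodule.span ℂ {ζ : X.E | ∃ ξ b, ζ = τ ξ b} : Set X.E) ∧
    (∀ ξ b b', τ ξ (b * b') = τ ξ b <• b') ∧
    (∀ ξ b, X.grade (τ ξ b) = τ (W.grade ξ) (BL.grade G b)) ∧
    (∀ g ξ b, X.gact g (τ ξ b) = τ (W.gact g ξ) (BL.act g b)) ∧
    (∀ a ξ b, (X.φ a).1 (τ ξ b) = τ ((W.φ a).1 ξ) b) ∧
    (∀ ξ b, X.F.1 (τ ξ b) = τ (W.F.1 ξ) b)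

/-- There is a homotopy between `X` and `Y`: an element of `ke_G(A, B[0,1])` whose evaluations at
`0` and `1` are `X` and `Y`. -/
def Homotopy (X Y : AsymptoticKasparovModule G A B) : Prop :=
  ∃ W : AsymptoticKasparovModule G A C(I, B), IsEvaluation 0 W X ∧ IsEvaluation 1 W Y

end AsymptoticKasparovModule

variable (G A B) in
/-- The set `KE_G(A, B)`: the quotient of `ke_G(A, B)` by the equivalence relation generated by
homotopy. -/
def KE : Type _ := Quot (AsymptoticKasparovModule.Homotopy (G := G) (A := A) (B := B))

/-- The class in `KE_G(A, B)` of an asymptotic Kasparov module. -/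
def KE.mk (X : AsymptoticKasparovModule G A B) : KE G A B :=
  Quot.mk _ X

end Fields

end KETheory

end

/-!
`ke_G(A, B)` becomes an abelian group under direct sums as soon as two kinds of homotopies are
available: constant ones, which identify unitarily isomorphic modules and make the sum of homotopy
classes well defined, and for every `(E, F)` a homotopy from `(E ⊕ E^op, F ⊕ -F)` to the zero
module.

Both are instances of one construction. Given a continuous function `c` on `[0,1]`, the paths
`[0,1] → E` that vanish on the zero set of `c` form a Hilbert `B[0,1]L`-module (`Cyl c E`). For
`c = 1` this is `C([0,1], E)`, for `c s = 1 - s` it is `C₀([0,1), E)`, whose fibre at `1` is zero.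
If `S` is an odd selfadjoint `G`-invariant operator that commutes with `A` in the graded sense and
anticommutes with `F`, and if `d² S² = 1 - c²`, then the operator `c F + d S` on paths is again an
asymptotic Kasparov module (`Rotation.cylinder`). Conditions `akm1`, `akm2` and `akm4` see only
`c F`, and for `akm3` one has `(c F + d S)² - 1 = c² (F² - 1)` (`Rotation.sq_sub_one`).
Multiplication by `c²` maps `𝓒(E)` to `𝓒(Cyl c E)`, since `c²` times the rank one operator of `ξ`,
`η` is the rank one operator of the paths `c ξ`, `c η` (`Cyl.famOp_mem_compacts`).

With `c = 1` and `S = 0` this is the constant homotopy. On `E ⊕ E^op` the interchange of the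
summands is odd, because the gradings are opposite, and serves as `S` for `F ⊕ -F`; with
`c s = 1 - s` the cylinder is a homotopy to zero (`homotopy_directSum_opposite`).
-/

noncomputable section

open Filter Topology MulOpposite
open scoped ZeroAtInfty RightActions WithCStarModule unitInterval CStarAlgebra

set_option linter.unusedSectionVars false

namespace KETheory

universe uG uA uB

/-! ### `B[0,1]L` as the algebra of paths in `BL` -/

section Paths

variable {B : Type*} [NonUnitalCStarAlgebra B]

/-- The evaluation `B[0,1]L → BL` at `s ∈ [0,1]`. -/
abbrev BL.eval (s : I) : BL C(I, B) →⋆ₙₐ[ℂ] BL B := BL.map (evalAt B s)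

lemma BL.eval_apply (s : I) (b : BL C(I, B)) (t : HalfLine) : BL.eval s b t = b t s := rfl

lemma BL.ext_eval {b b' : BL C(I, B)} (h : ∀ s, BL.eval s b = BL.eval s b') : b = b' := by
  ext t s
  exact congrArg (fun x : BL B => x t) (h s)

/-- An element of `B[0,1]L` is a path in `BL`: it is jointly continuous, hence uniformly continuous
in `s` for `t` in a compact set, and small for `t` outside of it. -/
lemma BL.continuous_eval (b : BL C(I, B)) : Continuous fun s => BL.eval s b := by
  refine continuous_iff_continuousAt.2 fun s₀ => Metric.tendsto_nhds.2 fun ε hε => ?_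
  have hb : ∀ᶠ t in cocompact HalfLine, ‖b t‖ < ε / 4 := by
    have h := (zero_at_infty b).norm
    rw [norm_zero] at h
    exact h.eventually (gt_mem_nhds (by positivity))
  obtain ⟨K, hK, hKb⟩ := mem_cocompact.1 hb
  have hc : Continuous fun p : HalfLine × I => b p.1 p.2 :=
    ContinuousEval.continuous_eval.comp (b.continuous.prodMap continuous_id)
  have h1 : ∀ᶠ s in 𝓝 s₀, ∀ t ∈ K, dist (b t s) (b t s₀) < ε / 2 := by
    refine hK.eventually_forall_of_forall_eventually fun t _ => ?_
    have hd : Continuous fun p : I × HalfLine => dist (b p.2 p.1) (b p.2 s₀) :=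
      (hc.comp continuous_swap).dist (hc.comp (continuous_snd.prodMk continuous_const))
    exact (hd.tendsto (s₀, t)).eventually (gt_mem_nhds (by simpa using half_pos hε))
  filter_upwards [h1] with s hs
  rw [dist_eq_norm]
  refine lt_of_le_of_lt (BL.norm_le_of_forall (half_pos hε).le fun t => ?_) (half_lt_self hε)
  change ‖b t s - b t s₀‖ ≤ _
  by_cases ht : t ∈ K
  · rw [← dist_eq_norm]; exact (hs t ht).le
  · have h2 : ‖b t‖ < ε / 4 := hKb ht
    have h3 := (b t).norm_coe_le_norm s
    have h4 := (b t).norm_coe_le_norm s₀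
    have h5 := norm_sub_le (b t s) (b t s₀)
    linarith

/-- The element of `B[0,1]L` given by a path in `BL`. -/
def BL.ofPath (h : C(I, BL B)) : BL C(I, B) where
  toFun t := ⟨fun s => h s t,
    (continuous_eval_const (F := BoundedContinuousFunction HalfLine B) t).comp
      ((ZeroAtInftyContinuousMap.isometry_toBCF (α := HalfLine) (β := B)).continuous.comp
        h.continuous)⟩
  continuous_toFun := by
    refine ContinuousMap.continuous_of_continuous_uncurry _ ?_
    have h1 : Continuous fun p : HalfLine × I => (h p.2).toBCF p.1 :=
      ContinuousEval.continuous_eval.comp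
        (((ZeroAtInftyContinuousMap.isometry_toBCF (α := HalfLine) (β := B)).continuous.comp
          (h.continuous.comp continuous_snd)).prodMk continuous_fst)
    exact h1
  zero_at_infty' := by
    refine Metric.tendsto_nhds.2 fun ε hε => ?_
    have key : ∀ᶠ t in cocompact HalfLine, ∀ s : I, s ∈ Set.univ → ‖h s t‖ < ε / 2 := by
      refine isCompact_univ.induction_on (p := fun S : Set I =>
        ∀ᶠ t in cocompact HalfLine, ∀ s : I, s ∈ S → ‖h s t‖ < ε / 2) ?_ ?_ ?_ ?_
      · exact Eventually.of_forall fun t s hs => hs.elim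
      · intro S S' hS h1
        filter_upwards [h1] with t ht s hs using ht s (hS hs)
      · intro S S' h1 h2
        filter_upwards [h1, h2] with t h1 h2 s hs using hs.elim (h1 s) (h2 s)
      · intro s₀ _
        refine ⟨{s | dist (h s) (h s₀) < ε / 4}, mem_nhdsWithin_of_mem_nhds
          (Metric.tendsto_nhds.1 (h.continuous.tendsto s₀) _ (by positivity)), ?_⟩
        have h1 := (zero_at_infty (h s₀)).norm
        rw [norm_zero] at h1
        filter_upwards [h1.eventually (gt_mem_nhds (show 0 < ε / 4 by positivity))] with t ht s hs
        have h2 : ‖(h s - h s₀) t‖ ≤ ‖h s - h s₀‖ := BL.norm_apply_le _ t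
        rw [← dist_eq_norm, ZeroAtInftyContinuousMap.sub_apply] at h2
        have h3 := norm_sub_norm_le (h s t) (h s₀ t)
        have h4 : dist (h s) (h s₀) < ε / 4 := hs
        linarith
    filter_upwards [key] with t ht
    rw [dist_zero_right]
    refine lt_of_le_of_lt ((ContinuousMap.norm_le _ (half_pos hε).le).2 fun s => ?_)
      (half_lt_self hε)
    exact (ht s trivial).le

@[simp] lemma BL.eval_ofPath (s : I) (h : C(I, BL B)) : BL.eval s (BL.ofPath h) = h s := by
  ext t; rfl

lemma BL.norm_eval_le (s : I) (b : BL C(I, B)) : ‖BL.eval s b‖ ≤ ‖b‖ :=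
  NonUnitalStarAlgHom.norm_apply_le _ _

lemma BL.norm_le_of_eval {b : BL C(I, B)} {r : ℝ} (hr : 0 ≤ r) (h : ∀ s, ‖BL.eval s b‖ ≤ r) :
    ‖b‖ ≤ r :=
  BL.norm_le_of_forall hr fun t => (ContinuousMap.norm_le _ hr).2 fun s =>
    (BL.norm_apply_le (BL.eval s b) t).trans (h s)

/-- Positivity in `B[0,1]L` is tested by the evaluations, as the negative part of a selfadjoint
element is preserved by `⋆`-homomorphisms. -/
lemma BL.nonneg_of_eval {b : BL C(I, B)} (h : ∀ s, 0 ≤ BL.eval s b) : 0 ≤ b := by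
  have hsa : IsSelfAdjoint b := BL.ext_eval fun s => by
    rw [map_star]; exact (IsSelfAdjoint.of_nonneg (h s))
  rw [← CFC.negPart_eq_zero_iff b hsa]
  refine BL.ext_eval fun s => ?_
  rw [map_zero, CFC.negPart_def]
  have h1 := NonUnitalStarAlgHomClass.map_cfcₙ (S := ℂ) (BL.eval s) (fun x : ℝ => x⁻) b
    (by fun_prop) (by simp) (map_continuous _) hsa (hsa.map (BL.eval s))
  rw [h1, ← CFC.negPart_def, CFC.negPart_eq_zero_iff _ (hsa.map (BL.eval s))]
  exact h s

end Paths

/-! ### Continuity of the operations of a Hilbert module -/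

section HilbertModule

variable {D : Type*} {E : Type*} [NonUnitalCStarAlgebra D] [PartialOrder D] [StarOrderedRing D]
  [NormedAddCommGroup E] [NormedSpace ℂ E] [SMul Dᵐᵒᵖ E] [CStarModule Dᵐᵒᵖ E]

lemma continuous_rinner : Continuous fun p : E × E => rinner D p.1 p.2 :=
  continuous_unop.comp (CStarModule.continuous_inner (A := Dᵐᵒᵖ) (E := E))

lemma norm_smul_right_le (ξ : E) (d : D) : ‖ξ <• d‖ ≤ ‖ξ‖ * ‖d‖ := by
  refine le_of_sq_le_sq ?_ (by positivity)
  rw [norm_sq_eq_rinner D, rinner_smul_right, rinner_smul_left]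
  calc _ ≤ ‖star d‖ * ‖rinner D ξ ξ‖ * ‖d‖ := (norm_mul_le _ _).trans (by
          gcongr; exact norm_mul_le _ _)
    _ = _ := by rw [norm_star, ← norm_sq_eq_rinner]; ring

lemma isBoundedBilinearMap_smul_right :
    IsBoundedBilinearMap ℂ fun p : E × D => p.1 <• p.2 where
  add_left ξ η d := smul_add_right D ξ η d
  smul_left c ξ d := smul_csmul_right D c ξ d
  add_right ξ d d' := ext_rinner D fun ζ => by
    simp only [rinner_smul_right, rinner_add_right, mul_add]
  smul_right c ξ d := ext_rinner D fun ζ => by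
    simp only [rinner_smul_right, rinner_csmul_right, mul_smul_comm]
  bound := ⟨1, one_pos, fun ξ d => by rw [one_mul]; exact norm_smul_right_le ξ d⟩

end HilbertModule

/-! ### The Hilbert module of paths vanishing on the zero set of a function -/

section Cylinder

/-- The space of continuous paths in `E` that vanish on the zero set of `c : [0,1] → ℝ`. -/
def pathSubmodule (c : C(I, ℝ)) (E : Type*) [NormedAddCommGroup E] [NormedSpace ℂ E] :
    Submodule ℂ C(I, E) where
  carrier := {f | ∀ s, c s = 0 → f s = 0}
  zero_mem' _ _ := rfl
  add_mem' := fun hf hg s hs => by simp [hf s hs, hg s hs]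
  smul_mem' := fun a f hf s hs => by simp [hf s hs]

/-- The Hilbert `B[0,1]L`-module of continuous paths in the Hilbert `BL`-module `E` that vanish on
the zero set of `c : [0,1] → ℝ`, with pointwise operations. For `c = 1` it is `C([0,1], E)`, and for
`c s = 1 - s` it is `C₀([0,1), E)`. -/
def Cyl (c : C(I, ℝ)) (E : Type*) [NormedAddCommGroup E] [NormedSpace ℂ E] : Type _ :=
  pathSubmodule c E

variable {c : C(I, ℝ)} {B E : Type*} [NonUnitalCStarAlgebra B]
  [NormedAddCommGroup E] [NormedSpace ℂ E]

instance : NormedAddCommGroup (Cyl c E) := inferInstanceAs (NormedAddCommGroup (pathSubmodule c E))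
instance : NormedSpace ℂ (Cyl c E) := inferInstanceAs (NormedSpace ℂ (pathSubmodule c E))

lemma isClosed_pathSubmodule : IsClosed (pathSubmodule c E : Set C(I, E)) := by
  have h : (pathSubmodule c E : Set C(I, E)) = ⋂ s, ⋂ (_ : c s = 0), {f | f s = 0} := by
    ext f; simp [pathSubmodule]
  rw [h]
  exact isClosed_iInter fun s => isClosed_iInter fun _ =>
    isClosed_eq (continuous_eval_const s) continuous_const

instance [CompleteSpace E] : CompleteSpace (Cyl c E) :=
  isClosed_pathSubmodule.completeSpace_coe

namespace Cyl

/-- The path `f : [0,1] → E` as an element of the module of paths. -/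
def mk (f : I → E) (hf : Continuous f) (h : ∀ s, c s = 0 → f s = 0) : Cyl c E := ⟨⟨f, hf⟩, h⟩

instance : FunLike (Cyl c E) I E where
  coe f := f.1
  coe_injective _ _ h := Subtype.ext (DFunLike.coe_injective h)

@[simp] lemma mk_apply (f : I → E) (hf : Continuous f) (h : ∀ s, c s = 0 → f s = 0) (s : I) :
    (mk f hf h : Cyl c E) s = f s := rfl
@[simp] lemma add_apply (f g : Cyl c E) (s : I) : (f + g) s = f s + g s := rfl
@[simp] lemma zero_apply (s : I) : (0 : Cyl c E) s = 0 := rfl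
@[simp] lemma smul_apply (a : ℂ) (f : Cyl c E) (s : I) : (a • f) s = a • f s := rfl

@[ext] lemma ext {f g : Cyl c E} (h : ∀ s, f s = g s) : f = g := DFunLike.ext _ _ h

protected lemma continuous (f : Cyl c E) : Continuous f := f.1.continuous

lemma eq_zero (f : Cyl c E) {s : I} (hs : c s = 0) : f s = 0 := f.2 s hs

lemma norm_apply_le (f : Cyl c E) (s : I) : ‖f s‖ ≤ ‖f‖ := f.1.norm_coe_le_norm s

lemma norm_le {f : Cyl c E} {r : ℝ} (hr : 0 ≤ r) (h : ∀ s, ‖f s‖ ≤ r) : ‖f‖ ≤ r :=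
  (ContinuousMap.norm_le f.1 hr).2 h

/-- The operator `(f s)_s ↦ (h s • T (f s))_s` on paths. -/
def fam (h : C(I, ℝ)) (T : E →L[ℂ] E) : Cyl c E →L[ℂ] Cyl c E :=
  LinearMap.mkContinuous
    { toFun := fun f => mk (fun s => (h s : ℂ) • T (f s))
        ((Complex.continuous_ofReal.comp h.continuous).smul (T.continuous.comp f.continuous))
        fun s hs => by simp [f.eq_zero hs]
      map_add' := fun f g => ext fun s => by simp
      map_smul' := fun a f => ext fun s => by simp [smul_comm a] }
    (‖h‖ * ‖T‖) fun f => norm_le (by positivity) fun s => by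
      change ‖(h s : ℂ) • T (f s)‖ ≤ _
      rw [norm_smul, Complex.norm_real, mul_assoc]
      gcongr
      · exact h.norm_coe_le_norm s
      · exact (T.le_opNorm _).trans (by gcongr; exact f.norm_apply_le s)

@[simp] lemma fam_apply (h : C(I, ℝ)) (T : E →L[ℂ] E) (f : Cyl c E) (s : I) :
    fam h T f s = (h s : ℂ) • T (f s) := rfl

/-- The pointwise application of a linear operator to paths. -/
def map (T : E →ₗ[ℂ] E) (hT : Continuous T) : Cyl c E →ₗ[ℂ] Cyl c E where
  toFun f := mk (fun s => T (f s)) (hT.comp f.continuous) fun s hs => by simp [f.eq_zero hs]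
  map_add' f g := ext fun s => by simp
  map_smul' a f := ext fun s => by simp

@[simp] lemma map_apply (T : E →ₗ[ℂ] E) (hT : Continuous T) (f : Cyl c E) (s : I) :
    map T hT f s = T (f s) := rfl

lemma norm_fam_le (h : C(I, ℝ)) (T : E →L[ℂ] E) : ‖(fam h T : Cyl c E →L[ℂ] Cyl c E)‖ ≤ ‖h‖ * ‖T‖ :=
  LinearMap.mkContinuous_norm_le _ (by positivity) _

variable (c E) in
/-- The path `s ↦ c s • f s` for an arbitrary path `f`. -/
def mulLeft : C(I, E) →L[ℂ] Cyl c E :=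
  LinearMap.mkContinuous
    { toFun := fun f => mk (fun s => (c s : ℂ) • f s)
        ((Complex.continuous_ofReal.comp c.continuous).smul f.continuous)
        fun s hs => by simp [hs]
      map_add' := fun f g => ext fun s => by simp
      map_smul' := fun a f => ext fun s => by simp [smul_comm a] }
    ‖c‖ fun f => norm_le (by positivity) fun s => by
      change ‖(c s : ℂ) • f s‖ ≤ _
      rw [norm_smul, Complex.norm_real]
      gcongr
      · exact c.norm_coe_le_norm s
      · exact f.norm_coe_le_norm s

@[simp] lemma mulLeft_apply (f : C(I, E)) (s : I) : mulLeft c E f s = (c s : ℂ) • f s := rfl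

/-- A path `f` that vanishes on the zero set of `c` is the limit of the paths
`c • (c / (c² + ε)) f`. -/
lemma dense_range_mulLeft : DenseRange (mulLeft c E) := by
  intro f
  refine Metric.mem_closure_iff.2 fun η₀ hη₀ => ?_
  obtain ⟨η, hη, hηη⟩ := exists_between hη₀
  have hK : IsCompact {s : I | η ≤ ‖f s‖} :=
    (isClosed_le continuous_const f.continuous.norm).isCompact
  obtain ⟨m, hm, hmK⟩ := hK.exists_forall_le' (f := fun s => c s ^ 2) (a := 0)
    (by fun_prop) fun s hs => by
      have hc : c s ≠ 0 := fun h => by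
        have h1 : η ≤ ‖f s‖ := hs
        rw [f.eq_zero h, norm_zero] at h1
        linarith
      positivity
  -- Where `‖f s‖ ≥ η`, one has `m ≤ c²`, so that `ε / (c² + ε) * ‖f s‖ ≤ ε / m * ‖f‖ ≤ η`.
  set ε := m * η / (‖f‖ + 1) with hε
  have hε0 : 0 < ε := by positivity
  have hpos : ∀ s, 0 < c s ^ 2 + ε := fun s => by positivity
  let g : C(I, E) := ⟨fun s => ((c s / (c s ^ 2 + ε) : ℝ) : ℂ) • f s,
    (Complex.continuous_ofReal.comp (c.continuous.div (by fun_prop) fun s => (hpos s).ne')).smul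
      f.continuous⟩
  refine ⟨_, ⟨g, rfl⟩, lt_of_le_of_lt ?_ hηη⟩
  rw [dist_eq_norm]
  refine norm_le hη.le fun s => ?_
  have h1 : (f - mulLeft c E g) s = ((ε / (c s ^ 2 + ε) : ℝ) : ℂ) • f s := by
    change f s - (c s : ℂ) • ((c s / (c s ^ 2 + ε) : ℝ) : ℂ) • f s = _
    rw [smul_smul, ← Complex.ofReal_mul]
    have h2 : ε / (c s ^ 2 + ε) = 1 - c s * (c s / (c s ^ 2 + ε)) := by
      have := (hpos s).ne'
      field_simp
      ring
    rw [h2]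
    push_cast
    rw [sub_smul, one_smul]
  rw [h1, norm_smul, Complex.norm_real, Real.norm_of_nonneg (by have := hpos s; positivity)]
  by_cases hs : η ≤ ‖f s‖
  · have h3 : ε / (c s ^ 2 + ε) ≤ ε / m := by
      gcongr
      have := hmK s hs
      linarith
    calc _ ≤ ε / m * (‖f‖ + 1) := by
          gcongr
          linarith [f.norm_apply_le s]
      _ = η := by rw [hε]; field_simp
  · have h3 : ε / (c s ^ 2 + ε) ≤ 1 := by
      rw [div_le_one (hpos s)]
      have := sq_nonneg (c s)
      linarith
    calc _ ≤ 1 * ‖f s‖ := by gcongr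
      _ ≤ η := by linarith

variable [SMul (BL B)ᵐᵒᵖ E] [CStarModule (BL B)ᵐᵒᵖ E]

instance : SMul (BL C(I, B))ᵐᵒᵖ (Cyl c E) where
  smul b f := mk (fun s => f s <• BL.eval s (unop b))
    (isBoundedBilinearMap_smul_right.continuous.comp
      (f.continuous.prodMk (BL.continuous_eval (unop b))))
    fun s hs => by
      rw [f.eq_zero hs]
      exact ext_rinner (BL B) fun ζ => by
        rw [rinner_smul_right, rinner_zero_right, zero_mul]

@[simp] lemma smul_right_apply (f : Cyl c E) (b : BL C(I, B)) (s : I) :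
    (f <• b) s = f s <• BL.eval s b := rfl

/-- The pointwise inner product of two paths. -/
def innerPath (f g : Cyl c E) : BL C(I, B) :=
  BL.ofPath ⟨fun s => rinner (BL B) (f s) (g s),
    continuous_rinner.comp (f.continuous.prodMk g.continuous)⟩

lemma eval_innerPath (f g : Cyl c E) (s : I) :
    BL.eval s (innerPath f g) = rinner (BL B) (f s) (g s) := BL.eval_ofPath _ _

instance : CStarModule (BL C(I, B))ᵐᵒᵖ (Cyl c E) where
  inner f g := op (innerPath f g)
  inner_add_right := unop_injective <| BL.ext_eval fun s => by
    change BL.eval s (innerPath _ _) = BL.eval s (innerPath _ _ + innerPath _ _)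
    simp only [map_add, eval_innerPath, add_apply, rinner_add_right]
  inner_self_nonneg {f} := by
    change 0 ≤ innerPath f f
    refine BL.nonneg_of_eval fun s => ?_
    rw [eval_innerPath]
    exact rinner_self_nonneg _ _
  inner_self {f} := by
    refine ⟨fun h => ext fun s => ?_, ?_⟩
    · have h1 : innerPath f f = (0 : BL C(I, B)) := op_injective h
      have h2 := norm_sq_eq_rinner (BL B) (f s)
      rw [← eval_innerPath, h1, map_zero, norm_zero] at h2
      simpa using h2
    · rintro rfl
      refine unop_injective <| BL.ext_eval fun s => ?_
      change BL.eval s (innerPath _ _) = BL.eval s 0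
      rw [eval_innerPath, zero_apply, rinner_zero_left, map_zero]
  inner_op_smul_right {b f g} := unop_injective <| BL.ext_eval fun s => by
    change BL.eval s (innerPath f (g <• unop b)) = BL.eval s (innerPath f g * unop b)
    rw [map_mul, eval_innerPath, eval_innerPath, smul_right_apply, rinner_smul_right]
  inner_smul_right_complex := unop_injective <| BL.ext_eval fun s => by
    change BL.eval s (innerPath _ _) = BL.eval s (_ • innerPath _ _)
    simp only [map_smul, eval_innerPath, smul_apply, rinner_csmul_right]
  star_inner f g := unop_injective <| BL.ext_eval fun s => by
    change BL.eval s (star (innerPath f g)) = BL.eval s (innerPath g f)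
    rw [map_star, eval_innerPath, eval_innerPath, star_rinner]
  norm_eq_sqrt_norm_inner_self f := by
    change ‖f‖ = √‖innerPath f f‖
    refine le_antisymm (norm_le (Real.sqrt_nonneg _) fun s => ?_) (Real.sqrt_le_iff.2
      ⟨norm_nonneg _, BL.norm_le_of_eval (by positivity) fun s => ?_⟩)
    · refine Real.le_sqrt_of_sq_le ?_
      rw [norm_sq_eq_rinner (BL B), ← eval_innerPath]
      exact BL.norm_eval_le _ _
    · rw [eval_innerPath, ← norm_sq_eq_rinner]
      gcongr
      exact f.norm_apply_le s

lemma eval_rinner (f g : Cyl c E) (s : I) :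
    BL.eval s (rinner (BL C(I, B)) f g) = rinner (BL B) (f s) (g s) := eval_innerPath f g s

variable (c) in
/-- The paths `s ↦ c s • ξ`, where `ξ` runs through generators of `E`, generate the module of paths;
by Bernstein approximation, the paths `s ↦ c s p s • ξ` with `p : [0,1] → ℝ` continuous and `ξ ∈ E`
span a dense subspace. -/
lemma countablyGenerated (h : CountablyGenerated (BL B) E) :
    CountablyGenerated (BL C(I, B)) (Cyl c E) := by
  obtain ⟨S, hS, hSd⟩ := h
  refine ⟨(fun ξ => mulLeft c E (.const I ξ)) '' S, hS.image _, ?_⟩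
  set V := Submodule.span ℂ {ζ : Cyl c E |
    ∃ ξ ∈ (fun ξ => mulLeft c E (.const I ξ)) '' S, ∃ d : BL C(I, B), ζ = ξ <• d} with hV
  have h1 : ∀ (p : C(I, ℝ)) (e : E), mulLeft c E (p • .const I e) ∈ V.topologicalClosure := by
    intro p e
    let L : E →ₗ[ℂ] Cyl c E :=
      { toFun := fun e => mulLeft c E (p • .const I e)
        map_add' := fun e e' => ext fun s => by simp
        map_smul' := fun a e => ext fun s => by
          simp only [mulLeft_apply, ContinuousMap.smul_apply', ContinuousMap.const_apply,
            RingHom.id_apply, smul_apply]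
          rw [smul_comm (p s) a, smul_comm (c s : ℂ) a] }
    have hL : Continuous L := (mulLeft c E).continuous.comp <|
      ContinuousMap.continuous_of_continuous_uncurry _ <|
        (p.continuous.comp continuous_snd).smul continuous_fst
    refine map_mem_closure (f := L) hL (hSd e) fun ζ hζ => ?_
    have : Submodule.span ℂ {ζ : E | ∃ ξ ∈ S, ∃ d : BL B, ζ = ξ <• d} ≤ V.comap L := by
      refine Submodule.span_le.2 ?_
      rintro _ ⟨ξ, hξ, d, rfl⟩
      refine Submodule.subset_span ⟨_, ⟨ξ, hξ, rfl⟩,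
        BL.ofPath ⟨fun s => (p s : ℂ) • d, by fun_prop⟩, ext fun s => ?_⟩
      change (c s : ℂ) • p s • (ξ <• d) = ((c s : ℂ) • ξ) <• ((p s : ℂ) • d)
      refine ext_rinner (BL B) fun ζ => ?_
      rw [← Complex.coe_smul (p s)]
      simp only [rinner_csmul_right, rinner_smul_right, smul_mul_assoc, mul_smul_comm]
      exact smul_comm _ _ _
    exact this hζ
  have h2 : ∀ g : C(I, E), mulLeft c E g ∈ V.topologicalClosure := fun g => by
    let : NormedSpace ℝ E := NormedSpace.restrictScalars ℝ ℂ E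
    refine V.isClosed_topologicalClosure.mem_of_tendsto
      (((mulLeft c E).continuous.tendsto g).comp (bernsteinApproximation_uniform g))
      (Eventually.of_forall fun n => ?_)
    simp only [Function.comp, bernsteinApproximation, map_sum]
    exact Submodule.sum_mem _ fun k _ => h1 _ _
  intro f
  have h3 := closure_mono (Set.range_subset_iff.2 h2) (dense_range_mulLeft f)
  rwa [V.isClosed_topologicalClosure.closure_eq] at h3

/-! ### Families of adjointable operators on paths -/

variable (c) in
/-- The adjointable operator `(f s)_s ↦ (h s • T (f s))_s` on paths. -/
def famOp (h : C(I, ℝ)) (T : Adj (BL B) E) : Adj (BL C(I, B)) (Cyl c E) :=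
  Adj.mk (fam h T.1) (fam h (star T).1) fun f g => BL.ext_eval fun s => by
    rw [eval_rinner, eval_rinner, fam_apply, fam_apply, rinner_csmul_left, rinner_csmul_right,
      rinner_apply_left]
    simp

@[simp] lemma famOp_apply (h : C(I, ℝ)) (T : Adj (BL B) E) (f : Cyl c E) (s : I) :
    (famOp c h T).1 f s = (h s : ℂ) • T.1 (f s) := rfl

lemma adj_ext {T S : Adj (BL C(I, B)) (Cyl c E)} (h : ∀ f s, T.1 f s = S.1 f s) : T = S :=
  Subtype.ext <| ContinuousLinearMap.ext fun f => ext (h f)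

lemma famOp_mul (h h' : C(I, ℝ)) (T T' : Adj (BL B) E) :
    famOp c h T * famOp c h' T' = famOp c (h * h') (T * T') :=
  adj_ext fun f s => by
    change (h s : ℂ) • T.1 ((h' s : ℂ) • T'.1 (f s)) = ((h s * h' s : ℝ) : ℂ) • T.1 (T'.1 (f s))
    rw [map_smul, smul_smul, Complex.ofReal_mul]

lemma famOp_add (h : C(I, ℝ)) (T T' : Adj (BL B) E) :
    famOp c h (T + T') = famOp c h T + famOp c h T' :=
  adj_ext fun _ _ => smul_add _ _ _

lemma famOp_sub (h : C(I, ℝ)) (T T' : Adj (BL B) E) :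
    famOp c h (T - T') = famOp c h T - famOp c h T' :=
  adj_ext fun _ _ => smul_sub _ _ _

lemma famOp_zero (h : C(I, ℝ)) : famOp c h (0 : Adj (BL B) E) = 0 :=
  adj_ext fun _ _ => smul_zero _

lemma famOp_smul (h : C(I, ℝ)) (a : ℂ) (T : Adj (BL B) E) :
    famOp c h (a • T) = a • famOp c h T :=
  adj_ext fun f s => smul_comm (h s : ℂ) a (T.1 (f s))

lemma famOp_star (h : C(I, ℝ)) (T : Adj (BL B) E) :
    famOp c h (star T) = star (famOp c h T) :=
  eq_star_of_rinner fun f g => BL.ext_eval fun s => by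
    rw [eval_rinner, eval_rinner, famOp_apply, famOp_apply, rinner_csmul_left, rinner_csmul_right,
      rinner_apply_left]
    simp

lemma norm_famOp_le (h : C(I, ℝ)) (T : Adj (BL B) E) : ‖famOp c h T‖ ≤ ‖h‖ * ‖T‖ :=
  norm_fam_le h T.1

lemma continuous_famOp (h : C(I, ℝ)) :
    Continuous fun T : Adj (BL B) E => famOp c h T := by
  refine LipschitzWith.continuous (K := ‖h‖₊) (LipschitzWith.of_dist_le_mul fun T T' => ?_)
  rw [dist_eq_norm, dist_eq_norm, ← famOp_sub]
  exact norm_famOp_le _ _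

/-- For the rank one operator of `ξ`, `η`, the family `c² θ_{ξ,η}` is the rank one operator of the
paths `c ξ` and `c η`. -/
lemma famOp_mem_compacts {K : Adj (BL B) E} (hK : K ∈ compacts (BL B) E) :
    famOp c (c * c) K ∈ compacts (BL C(I, B)) (Cyl c E) := by
  refine map_mem_closure (continuous_famOp (c * c)) hK fun R hR => ?_
  change famOp c (c * c) R ∈ Submodule.span ℂ _
  induction hR using Submodule.span_induction with
  | mem R hR =>
    obtain ⟨ξ, η, hR⟩ := hR
    refine Submodule.subset_span ⟨mulLeft c E (.const I ξ), mulLeft c E (.const I η),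
      fun f => ext fun s => ?_⟩
    rw [famOp_apply, smul_right_apply, eval_rinner, hR, mulLeft_apply, mulLeft_apply,
      ContinuousMap.const_apply, ContinuousMap.const_apply]
    refine ext_rinner (BL B) fun ζ => ?_
    simp only [rinner_csmul_right, rinner_csmul_left, rinner_smul_right, ContinuousMap.mul_apply,
      Complex.ofReal_mul, smul_mul_assoc, mul_smul_comm, smul_smul, Complex.star_def,
      Complex.conj_ofReal]
  | zero => rw [famOp_zero]; exact Submodule.zero_mem _
  | add R S _ _ h1 h2 => rw [famOp_add]; exact Submodule.add_mem _ h1 h2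
  | smul a R _ h1 => rw [famOp_smul]; exact Submodule.smul_mem _ a h1

/-- The seminorm of the fibre at `t` of the module of paths is the supremum over `s` of those of the
modules at `s`. -/
lemma fiberSeminorm_le_iff {t : HalfLine} {f : Cyl c E} {r : ℝ} (hr : 0 ≤ r) :
    fiberSeminorm C(I, B) t f ≤ r ↔ ∀ s, fiberSeminorm B t (f s) ≤ r := by
  simp only [fiberSeminorm, Real.sqrt_le_left hr]
  rw [ContinuousMap.norm_le _ (by positivity)]
  exact forall_congr' fun s => by rw [← eval_rinner, BL.eval_apply]

variable [CompleteSpace E]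

lemma scalarOp_eq_famOp (a : C₀(HalfLine, ℂ)) :
    (scalarOp a : Adj (BL C(I, B)) (Cyl c E)) = famOp c 1 (scalarOp a : Adj (BL B) E) := by
  refine KETheory.adj_ext fun f g => BL.ext_eval fun s => ?_
  rw [scalarOp_apply, rinner_scalarAct, eval_rinner, famOp_apply, scalarOp_apply,
    rinner_csmul_right, rinner_scalarAct, ← eval_rinner]
  ext t
  simp

lemma _root_.KETheory.IsLocallyCompactValued.famOp {K : Adj (BL B) E}
    (hK : IsLocallyCompactValued K) : IsLocallyCompactValued (famOp c (c * c) K) := fun a => by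
  rw [scalarOp_eq_famOp, famOp_mul, mul_one]
  exact famOp_mem_compacts (hK a)

lemma _root_.KETheory.IsVanishing.famOp (h : C(I, ℝ)) {T : Adj (BL B) E} (hT : IsVanishing T) :
    IsVanishing (famOp c h T) := by
  intro ε hε
  filter_upwards [hT (ε / (‖h‖ + 1)) (by positivity)] with t ht f
  have h0 := fiberSeminorm_nonneg (B := C(I, B)) t f
  refine (fiberSeminorm_le_iff (by positivity)).2 fun s => ?_
  have h1 : fiberSeminorm B t ((h s : ℂ) • T.1 (f s)) = ‖h s‖ * fiberSeminorm B t (T.1 (f s)) := by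
    simp only [fiberSeminorm]
    rw [rinner_csmul_left, rinner_csmul_right, smul_smul, ZeroAtInftyContinuousMap.smul_apply,
      norm_smul, Real.sqrt_mul (norm_nonneg _), norm_mul, norm_star, Complex.norm_real,
      Real.sqrt_mul_self (norm_nonneg _)]
  rw [famOp_apply, h1]
  have h2 : fiberSeminorm B t (f s) ≤ fiberSeminorm C(I, B) t f :=
    (fiberSeminorm_le_iff h0).1 le_rfl s
  calc _ ≤ (‖h‖ + 1) * (ε / (‖h‖ + 1) * fiberSeminorm C(I, B) t f) := by
        gcongr
        · exact fiberSeminorm_nonneg _ _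
        · linarith [h.norm_coe_le_norm s]
        · exact (ht _).trans (by gcongr)
    _ = _ := by field_simp

end Cyl

end Cylinder

/-! ### The cylinder of an asymptotic Kasparov module -/

section CylinderModules

variable {G : Type uG} {A : Type uA} {B : Type uB} [Group G] [TopologicalSpace G]
  [NonUnitalCStarAlgebra A] [NonUnitalCStarAlgebra B]
  [GradedGCStarAlgebra G A] [GradedGCStarAlgebra G B]

lemma BL.eval_act (g : G) (b : BL C(I, B)) (s : I) :
    BL.eval s (BL.act g b) = BL.act g (BL.eval s b) := rfl

lemma BL.eval_grade (b : BL C(I, B)) (s : I) :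
    BL.eval s (BL.grade G b) = BL.grade G (BL.eval s b) := rfl

namespace ContinuousField

lemma norm_grade_le (M : ContinuousField G A B) (ξ : M.E) : ‖M.grade ξ‖ ≤ ‖ξ‖ := by
  refine le_of_sq_le_sq ?_ (norm_nonneg _)
  rw [norm_sq_eq_rinner (BL B), norm_sq_eq_rinner (BL B), M.rinner_grade]
  exact NonUnitalStarAlgHom.norm_apply_le _ _

lemma continuous_grade (M : ContinuousField G A B) : Continuous M.grade :=
  AddMonoidHomClass.continuous_of_bound M.grade 1 fun ξ => by
    rw [one_mul]; exact M.norm_grade_le ξ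

lemma continuous_gact_apply (M : ContinuousField G A B) (g : G) : Continuous (M.gact g) :=
  M.continuous_gact.comp (continuous_const.prodMk continuous_id)

/-- The continuous field of `G`-`(A, B[0,1])`-modules of paths in `M` that vanish on the zero set of
`c`, with pointwise operations. -/
def cylinder (M : ContinuousField G A B) (c : C(I, ℝ)) : ContinuousField G A C(I, B) where
  E := Cyl c M.E
  countablyGenerated := Cyl.countablyGenerated c M.countablyGenerated
  grade := Cyl.map M.grade M.continuous_grade
  grade_grade f := Cyl.ext fun s => M.grade_grade (f s)
  grade_smul f b := Cyl.ext fun s => M.grade_smul (f s) (BL.eval s b)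
  rinner_grade f f' := BL.ext_eval fun s => by
    rw [Cyl.eval_rinner, BL.eval_grade, Cyl.eval_rinner]
    exact M.rinner_grade (f s) (f' s)
  gact g := Cyl.map (M.gact g) (M.continuous_gact_apply g)
  gact_one f := Cyl.ext fun s => M.gact_one (f s)
  gact_mul g h f := Cyl.ext fun s => M.gact_mul g h (f s)
  continuous_gact := by
    have h : Continuous fun p : (G × Cyl c M.E) × I => M.gact p.1.1 (p.1.2 p.2) := by
      have h1 : Continuous fun p : (G × Cyl c M.E) × I => p.1.2.1 p.2 :=
        ContinuousEval.continuous_eval.comp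
          ((continuous_subtype_val.comp (continuous_snd.comp continuous_fst)).prodMk
            continuous_snd)
      exact M.continuous_gact.comp ((continuous_fst.comp continuous_fst).prodMk h1)
    exact (ContinuousMap.continuous_of_continuous_uncurry
      (fun p : G × Cyl c M.E => (Cyl.map (M.gact p.1) (M.continuous_gact_apply p.1) p.2).1)
      h).subtype_mk _
  gact_smul g f b := Cyl.ext fun s => M.gact_smul g (f s) (BL.eval s b)
  rinner_gact g f f' := BL.ext_eval fun s => by
    rw [Cyl.eval_rinner, BL.eval_act, Cyl.eval_rinner]
    exact M.rinner_gact g (f s) (f' s)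
  grade_gact g f := Cyl.ext fun s => M.grade_gact g (f s)
  φ :=
    { toFun := fun a => Cyl.famOp c 1 (M.φ a)
      map_smul' := fun z a => by rw [map_smul]; exact Cyl.famOp_smul _ _ _
      map_zero' := by rw [map_zero]; exact Cyl.famOp_zero _
      map_add' := fun a b => by rw [map_add]; exact Cyl.famOp_add _ _ _
      map_mul' := fun a b => by rw [map_mul, Cyl.famOp_mul, mul_one]
      map_star' := fun a => by rw [map_star]; exact Cyl.famOp_star _ _ }
  gact_φ g a f := Cyl.ext fun s => by
    simpa using M.gact_φ g a (f s)
  grade_φ a f := Cyl.ext fun s => by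
    simpa using M.grade_φ a (f s)

lemma conj_cylinder (M : ContinuousField G A B) (c h : C(I, ℝ)) (g : G) (T : Adj (BL B) M.E) :
    (M.cylinder c).conj g (Cyl.famOp c h T) = Cyl.famOp c h (M.conj g T) :=
  Cyl.adj_ext fun f s => map_smul (M.gact g) (h s : ℂ) (T.1 (M.gact g⁻¹ (f s)))

end ContinuousField

namespace AsymptoticKasparovModule

/-- The data that allow to rotate `F` into a degenerate operator: an odd, `G`-invariant, selfadjoint
operator `S` that commutes (in the graded sense) with `A` and anticommutes with `F`, and functions
`c`, `d` such that `d² S² = 1 - c²`. Then `(c F + d S)² - 1 = c² (F² - 1)`. -/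
structure Rotation (X : AsymptoticKasparovModule G A B) (c d : C(I, ℝ)) where
  /-- The operator into which `F` is rotated. -/
  S : Adj (BL B) X.E
  star_S : star S = S
  odd_S : ∀ ξ, X.grade (S.1 ξ) = -S.1 (X.grade ξ)
  S_φ : ∀ a, S * X.φ a = X.φ (GradedGCStarAlgebra.grade G a) * S
  conj_S : ∀ g, X.toContinuousField.conj g S = S
  anticomm : X.F * S + S * X.F = 0
  sq : ∀ s, ((d s ^ 2 : ℝ) : ℂ) • (S * S) = ((1 - c s ^ 2 : ℝ) : ℂ) • 1

namespace Rotation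

variable {X : AsymptoticKasparovModule G A B} {c d : C(I, ℝ)} (R : Rotation X c d)

open Cyl

lemma sq_sub_one : (famOp c c X.F + famOp c d R.S) * (famOp c c X.F + famOp c d R.S) - 1
    = famOp c (c * c) (X.F * X.F - 1) := by
  refine Cyl.adj_ext fun f s => ?_
  have h1 : R.S.1 (X.F.1 (f s)) = -X.F.1 (R.S.1 (f s)) := by
    have h := congrArg (fun T : Adj (BL B) X.E => T.1 (f s)) R.anticomm
    exact eq_neg_of_add_eq_zero_right h
  have h2 : ((d s ^ 2 : ℝ) : ℂ) • R.S.1 (R.S.1 (f s)) = ((1 - c s ^ 2 : ℝ) : ℂ) • f s :=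
    congrArg (fun T : Adj (BL B) X.E => T.1 (f s)) (R.sq s)
  change (c s : ℂ) • X.F.1 ((c s : ℂ) • X.F.1 (f s) + (d s : ℂ) • R.S.1 (f s))
    + (d s : ℂ) • R.S.1 ((c s : ℂ) • X.F.1 (f s) + (d s : ℂ) • R.S.1 (f s)) - f s
    = ((c s * c s : ℝ) : ℂ) • (X.F.1 (X.F.1 (f s)) - f s)
  simp only [map_add, map_smul, smul_add, h1, smul_smul]
  push_cast at h2 ⊢
  rw [pow_two] at h2
  rw [h2]
  module

lemma conj_cylinder (g : G) :
    (X.toContinuousField.cylinder c).conj g (famOp c c X.F + famOp c d R.S)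
      = famOp c c (X.toContinuousField.conj g X.F) + famOp c d R.S := by
  conv_rhs => rw [← R.conj_S g]
  refine Cyl.adj_ext fun f s => ?_
  exact (map_add (X.gact g) _ _).trans
    (congrArg₂ (· + ·) (map_smul (X.gact g) _ _) (map_smul (X.gact g) _ _))

/-- The module of paths in `X.E` that vanish on the zero set of `c`, with the operator
`c F + d S`. -/
def cylinder : AsymptoticKasparovModule G A C(I, B) where
  toContinuousField := X.toContinuousField.cylinder c
  F := famOp c c X.F + famOp c d R.S
  odd_F f := Cyl.ext fun s => by
    let f' : Cyl c X.E := f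
    change X.grade ((c s : ℂ) • X.F.1 (f' s) + (d s : ℂ) • R.S.1 (f' s))
      = -((c s : ℂ) • X.F.1 (X.grade (f' s)) + (d s : ℂ) • R.S.1 (X.grade (f' s)))
    rw [map_add, map_smul, map_smul, X.odd_F, R.odd_S]
    module
  continuous_F := by
    simp_rw [R.conj_cylinder]
    exact ((continuous_famOp c).comp X.continuous_F).add continuous_const
  akm1 a := by
    have e : famOp c c ((X.F - star X.F) * X.φ a) = (famOp c c X.F + famOp c d R.S
        - star (famOp c c X.F + famOp c d R.S)) * famOp c 1 (X.φ a) := by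
      rw [star_add, ← famOp_star, ← famOp_star, R.star_S, add_sub_add_right_eq_sub, ← famOp_sub,
        famOp_mul, mul_one]
    have h := (X.akm1 a).famOp (c := c) c
    rw [e] at h
    exact h
  akm2 a := by
    have e : famOp c c (X.F * X.φ a - X.φ (GradedGCStarAlgebra.grade G a) * X.F)
        = (famOp c c X.F + famOp c d R.S) * famOp c 1 (X.φ a)
          - famOp c 1 (X.φ (GradedGCStarAlgebra.grade G a))
            * (famOp c c X.F + famOp c d R.S) := by
      rw [add_mul, mul_add, famOp_mul, famOp_mul, famOp_mul, famOp_mul, mul_one, mul_one, one_mul,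
        one_mul, R.S_φ, add_sub_add_right_eq_sub, famOp_sub]
    have h := (X.akm2 a).famOp (c := c) c
    rw [e] at h
    exact h
  akm3 a := by
    obtain ⟨P, K, J, hK, hJ, h⟩ := X.akm3 a
    refine ⟨famOp c c P, famOp c (c * c) K, famOp c (c * c) J, hK.famOp, hJ.famOp _, ?_⟩
    have e : famOp c 1 (X.φ a) * ((famOp c c X.F + famOp c d R.S)
        * (famOp c c X.F + famOp c d R.S) - 1) * star (famOp c 1 (X.φ a))
        = star (famOp c c P) * famOp c c P + (famOp c (c * c) K + famOp c (c * c) J) := by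
      rw [R.sq_sub_one, ← famOp_star, famOp_mul, famOp_mul, mul_one, one_mul, h, ← famOp_star,
        famOp_mul, ← famOp_add, ← famOp_add]
    exact e
  akm4 g a := by
    have e : famOp c c ((X.toContinuousField.conj g X.F - X.F) * X.φ a)
        = (famOp c c (X.toContinuousField.conj g X.F) + famOp c d R.S
          - (famOp c c X.F + famOp c d R.S)) * famOp c 1 (X.φ a) := by
      rw [add_sub_add_right_eq_sub, ← famOp_sub, famOp_mul, mul_one]
    have h := (X.akm4 g a).famOp (c := c) c
    rw [e] at h
    exact (congrArg (fun T : Adj (BL C(I, B)) (Cyl c X.E) => IsVanishing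
      ((T - (famOp c c X.F + famOp c d R.S)) * famOp c 1 (X.φ a))) (R.conj_cylinder g)).mpr h

end Rotation

end AsymptoticKasparovModule

end CylinderModules

/-! ### Unitary equivalence and the evaluations of the cylinder -/

section Equivalences

variable {G : Type uG} {A : Type uA} {B : Type uB} [Group G] [TopologicalSpace G]
  [NonUnitalCStarAlgebra A] [NonUnitalCStarAlgebra B]
  [GradedGCStarAlgebra G A] [GradedGCStarAlgebra G B]

namespace AsymptoticKasparovModule

/-- A unitary isomorphism of asymptotic Kasparov modules: a surjective linear map that preserves the
inner products and intertwines all the structure. -/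
structure UnitaryEquiv (X Y : AsymptoticKasparovModule G A B) where
  /-- The underlying linear map. -/
  u : X.E →ₗ[ℂ] Y.E
  surjective : Function.Surjective u
  rinner_u : ∀ ξ η, rinner (BL B) (u ξ) (u η) = rinner (BL B) ξ η
  grade_u : ∀ ξ, Y.grade (u ξ) = u (X.grade ξ)
  gact_u : ∀ g ξ, Y.gact g (u ξ) = u (X.gact g ξ)
  φ_u : ∀ a ξ, (Y.φ a).1 (u ξ) = u ((X.φ a).1 ξ)
  F_u : ∀ ξ, Y.F.1 (u ξ) = u (X.F.1 ξ)

lemma UnitaryEquiv.smul_u {X Y : AsymptoticKasparovModule G A B} (e : UnitaryEquiv X Y) (ξ : X.E)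
    (b : BL B) : e.u (ξ <• b) = e.u ξ <• b :=
  ext_rinner (BL B) fun ζ => by
    obtain ⟨η, rfl⟩ := e.surjective ζ
    rw [e.rinner_u, rinner_smul_right, rinner_smul_right, e.rinner_u]

/-- The identity as a unitary isomorphism. -/
def UnitaryEquiv.refl (X : AsymptoticKasparovModule G A B) : UnitaryEquiv X X where
  u := LinearMap.id
  surjective := Function.surjective_id
  rinner_u _ _ := rfl
  grade_u _ := rfl
  gact_u _ _ := rfl
  φ_u _ _ := rfl
  F_u _ := rfl

/-- Where `c = 1` and `d = 0`, the cylinder evaluates to the module itself. -/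
lemma Rotation.isEvaluation {X Y : AsymptoticKasparovModule G A B} {c d : C(I, ℝ)}
    (R : Rotation X c d) (e : UnitaryEquiv X Y) {s : I} (hc : c s = 1) (hd : d s = 0) :
    IsEvaluation s R.cylinder Y := by
  let v : Cyl c X.E →ₗ[ℂ] BL B →ₗ[ℂ] X.E := LinearMap.mk₂ ℂ (fun f b => f s <• b)
    (fun f f' b => smul_add_right (BL B) (f s) (f' s) b)
    (fun z f b => smul_csmul_right (BL B) z (f s) b)
    (fun f b b' => isBoundedBilinearMap_smul_right.add_right (f s) b b')
    (fun z f b => isBoundedBilinearMap_smul_right.smul_right z (f s) b)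
  let τ : Cyl c X.E →ₗ[ℂ] BL B →ₗ[ℂ] Y.E := v.compr₂ e.u
  have hτ : ∀ (f : Cyl c X.E) b, τ f b = e.u (f s) <• b := fun f b => e.smul_u _ _
  have h1 : ∀ (f f' : Cyl c X.E) b b', rinner (BL B) (τ f b) (τ f' b')
      = star b * BL.eval s (rinner (BL C(I, B)) f f') * b' := fun f f' b b' => by
    rw [hτ, hτ, rinner_smul_right, rinner_smul_left, e.rinner_u, Cyl.eval_rinner]
  have h2 : ∀ ζ, ζ ∈ closure (Submodule.span ℂ {ζ : Y.E | ∃ f b, ζ = τ f b} : Set Y.E) := by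
    intro ζ
    obtain ⟨ξ, rfl⟩ := e.surjective ζ
    have := (CStarAlgebra.increasingApproximateUnit (BL B)).neBot
    refine mem_closure_of_tendsto (tendsto_smul_approximateUnit (B := B) (e.u ξ))
      (Eventually.of_forall fun b => Submodule.subset_span
        ⟨Cyl.mulLeft c X.E (.const I ξ), b, ?_⟩)
    rw [hτ, Cyl.mulLeft_apply, hc, ContinuousMap.const_apply, Complex.ofReal_one, one_smul]
  have h3 : ∀ (f : Cyl c X.E) b b', τ f (b * b') = τ f b <• b' := fun f b b' => by
    rw [hτ, hτ]
    exact ext_rinner (BL B) fun ζ => by simp only [rinner_smul_right, mul_assoc]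
  have h4 : ∀ (f : Cyl c X.E) b,
      Y.grade (τ f b) = τ (Cyl.map X.grade X.continuous_grade f) (BL.grade G b) := fun f b => by
    rw [hτ, Y.grade_smul, e.grade_u, hτ, Cyl.map_apply]
  have h5 : ∀ g (f : Cyl c X.E) b,
      Y.gact g (τ f b) = τ (Cyl.map (X.gact g) (X.continuous_gact_apply g) f) (BL.act g b) :=
    fun g f b => by rw [hτ, Y.gact_smul, e.gact_u, hτ, Cyl.map_apply]
  have h6 : ∀ a (f : Cyl c X.E) b,
      (Y.φ a).1 (τ f b) = τ ((Cyl.famOp c 1 (X.φ a)).1 f) b := fun a f b => by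
    rw [hτ, adj_smul, e.φ_u, hτ, Cyl.famOp_apply, ContinuousMap.one_apply, Complex.ofReal_one,
      one_smul]
  have h7 : ∀ (f : Cyl c X.E) b,
      Y.F.1 (τ f b) = τ ((Cyl.famOp c c X.F + Cyl.famOp c d R.S).1 f) b := fun f b => by
    have h : (Cyl.famOp c c X.F + Cyl.famOp c d R.S).1 f s = X.F.1 (f s) := by
      change (c s : ℂ) • X.F.1 (f s) + (d s : ℂ) • R.S.1 (f s) = _
      rw [hc, hd, Complex.ofReal_one, Complex.ofReal_zero, one_smul, zero_smul, add_zero]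
    rw [hτ, adj_smul, e.F_u, hτ, h]
  exact ⟨τ, h1, h2, h3, h4, h5, h6, h7⟩

/-- Where `c = 0`, the cylinder evaluates to a zero module. -/
lemma Rotation.isEvaluation_zero {X Z : AsymptoticKasparovModule G A B} {c d : C(I, ℝ)}
    (R : Rotation X c d) [Subsingleton Z.E] {s : I} (hc : c s = 0) :
    IsEvaluation s R.cylinder Z := by
  refine ⟨0, fun f f' b b' => ?_, fun ζ => ?_, fun _ _ _ => Subsingleton.elim _ _,
    fun _ _ => Subsingleton.elim _ _, fun _ _ _ => Subsingleton.elim _ _,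
    fun _ _ _ => Subsingleton.elim _ _, fun _ _ => Subsingleton.elim _ _⟩
  · have h : BL.map (evalAt B s) (rinner (BL C(I, B)) f f') = 0 := by
      let f₀ : Cyl c X.E := f
      refine (Cyl.eval_rinner (B := B) (c := c) (E := X.E) f f' s).trans ?_
      rw [f₀.eq_zero hc, rinner_zero_left]
    rw [h, mul_zero, zero_mul]
    exact rinner_zero_left _ _
  · rw [Subsingleton.elim ζ 0]
    exact subset_closure (Submodule.zero_mem _)

/-- The constant rotation, which leaves `F` unchanged. -/
def Rotation.const (X : AsymptoticKasparovModule G A B) : Rotation X 1 0 where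
  S := 0
  star_S := star_zero _
  odd_S ξ := by simp
  S_φ a := by simp
  conj_S g := Subtype.ext <| ContinuousLinearMap.ext fun ξ => map_zero (X.gact g)
  anticomm := by simp
  sq s := by simp

/-- Unitarily isomorphic modules are the ends of a constant homotopy. -/
lemma UnitaryEquiv.homotopy {X Y : AsymptoticKasparovModule G A B} (e : UnitaryEquiv X Y) :
    Homotopy X Y :=
  ⟨(Rotation.const X).cylinder, (Rotation.const X).isEvaluation (.refl X) rfl rfl,
    (Rotation.const X).isEvaluation e rfl rfl⟩

lemma Rotation.homotopy_zero {X Z : AsymptoticKasparovModule G A B} {c d : C(I, ℝ)}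
    (R : Rotation X c d) [Subsingleton Z.E] (hc : c 0 = 1) (hd : d 0 = 0) (hc' : c 1 = 0) :
    Homotopy X Z :=
  ⟨R.cylinder, R.isEvaluation (.refl X) hc hd, R.isEvaluation_zero hc'⟩

/-! ### Direct sums and opposites of homotopies -/

lemma IsEvaluation.directSum {s : I} {W W' : AsymptoticKasparovModule G A C(I, B)}
    {X X' : AsymptoticKasparovModule G A B} (h : IsEvaluation s W X) (h' : IsEvaluation s W' X') :
    IsEvaluation s (W.directSum W') (X.directSum X') := by
  obtain ⟨τ, h1, h2, h3, h4, h5, h6, h7⟩ := h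
  obtain ⟨τ', h1', h2', h3', h4', h5', h6', h7'⟩ := h'
  let ρ : DSum (BL C(I, B)) W.E W'.E →ₗ[ℂ] BL B →ₗ[ℂ] DSum (BL B) X.E X'.E :=
    LinearMap.mk₂ ℂ (fun f b => dpair (BL B) (τ f.fst b) (τ' f.snd b))
    (fun f g b => dsum_ext (LinearMap.map_add₂ τ _ _ _) (LinearMap.map_add₂ τ' _ _ _))
    (fun z f b => dsum_ext (LinearMap.map_smul₂ τ _ _ _) (LinearMap.map_smul₂ τ' _ _ _))
    (fun f b b' => dsum_ext (map_add _ _ _) (map_add _ _ _))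
    (fun z f b => dsum_ext (map_smul _ _ _) (map_smul _ _ _))
  refine ⟨ρ, fun f f' b b' => ?_, ?_, 
    fun f b b' => dsum_ext (D := BL B) (h3 _ _ _) (h3' _ _ _),
    fun f b => dsum_ext (D := BL B) (h4 _ _) (h4' _ _),
    fun g f b => dsum_ext (D := BL B) (h5 _ _ _) (h5' _ _ _),
    fun a f b => dsum_ext (D := BL B) (h6 _ _ _) (h6' _ _ _),
    fun f b => dsum_ext (D := BL B) (h7 _ _) (h7' _ _)⟩
  · let f₀ : DSum (BL C(I, B)) W.E W'.E := f
    let f₁ : DSum (BL C(I, B)) W.E W'.E := f'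
    change rinner (BL B) (τ f₀.fst b) (τ f₁.fst b') + rinner (BL B) (τ' f₀.snd b) (τ' f₁.snd b')
      = star b * BL.map (evalAt B s) (rinner (BL C(I, B)) f₀.fst f₁.fst
        + rinner (BL C(I, B)) f₀.snd f₁.snd) * b'
    rw [h1, h1', map_add, mul_add, add_mul]
  · set V := Submodule.span ℂ {ζ : DSum (BL B) X.E X'.E | ∃ ξ b, ζ = ρ ξ b} with hV
    let e := (WithCStarModule.equivL ℂ (A := (BL B)ᵐᵒᵖ) (E := X.E × X'.E)).symm
    let i : X.E →L[ℂ] DSum (BL B) X.E X'.E :=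
      (e : X.E × X'.E →L[ℂ] DSum (BL B) X.E X'.E) ∘L ContinuousLinearMap.inl ℂ X.E X'.E
    let i' : X'.E →L[ℂ] DSum (BL B) X.E X'.E :=
      (e : X.E × X'.E →L[ℂ] DSum (BL B) X.E X'.E) ∘L ContinuousLinearMap.inr ℂ X.E X'.E
    have k : ∀ ξ, i ξ ∈ V.topologicalClosure := fun ξ => by
      refine map_mem_closure i.continuous (h2 ξ) fun ζ hζ => ?_
      have : Submodule.span ℂ {ζ : X.E | ∃ ξ b, ζ = τ ξ b} ≤ V.comap i.toLinearMap := by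
        refine Submodule.span_le.2 ?_
        rintro _ ⟨ξ, b, rfl⟩
        exact Submodule.subset_span ⟨dpair (BL C(I, B)) ξ 0, b,
          dsum_ext rfl (LinearMap.map_zero₂ τ' b).symm⟩
      exact this hζ
    have k' : ∀ ξ, i' ξ ∈ V.topologicalClosure := fun ξ => by
      refine map_mem_closure i'.continuous (h2' ξ) fun ζ hζ => ?_
      have : Submodule.span ℂ {ζ : X'.E | ∃ ξ b, ζ = τ' ξ b} ≤ V.comap i'.toLinearMap := by
        refine Submodule.span_le.2 ?_
        rintro _ ⟨ξ, b, rfl⟩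
        exact Submodule.subset_span ⟨dpair (BL C(I, B)) 0 ξ, b,
          dsum_ext (LinearMap.map_zero₂ τ b).symm rfl⟩
      exact this hζ
    have key : ∀ x : DSum (BL B) X.E X'.E, x ∈ V.topologicalClosure := fun x => by
      have h3 := Submodule.add_mem _ (k x.fst) (k' x.snd)
      have h4 : i x.fst + i' x.snd = x :=
        dsum_ext (add_zero x.fst) (zero_add x.snd)
      rwa [h4] at h3
    exact key

lemma Homotopy.directSum {X Y X' Y' : AsymptoticKasparovModule G A B} (h : Homotopy X Y)
    (h' : Homotopy X' Y') : Homotopy (X.directSum X') (Y.directSum Y') := by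
  obtain ⟨W, h0, h1⟩ := h
  obtain ⟨W', h0', h1'⟩ := h'
  exact ⟨W.directSum W', h0.directSum h0', h1.directSum h1'⟩

lemma IsEvaluation.opposite {s : I} {W : AsymptoticKasparovModule G A C(I, B)}
    {X : AsymptoticKasparovModule G A B} (h : IsEvaluation s W X) :
    IsEvaluation s W.opposite X.opposite := by
  obtain ⟨τ, h1, h2, h3, h4, h5, h6, h7⟩ := h
  refine ⟨τ, h1, h2, h3, fun f b => ?_, h5, fun a => h6 (GradedGCStarAlgebra.grade G a),
    fun f b => ?_⟩
  · let f' : W.E := f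
    change -X.grade (τ f' b) = τ (-W.grade f') (BL.grade G b)
    rw [h4, LinearMap.map_neg₂]
  · let f' : W.E := f
    change -X.F.1 (τ f' b) = τ (-W.F.1 f') b
    rw [h7, LinearMap.map_neg₂]

lemma Homotopy.opposite {X Y : AsymptoticKasparovModule G A B} (h : Homotopy X Y) :
    Homotopy X.opposite Y.opposite := by
  obtain ⟨W, h0, h1⟩ := h
  exact ⟨W.opposite, h0.opposite, h1.opposite⟩

/-! ### The laws of an abelian group -/

/-- Interchanging the summands. -/
def directSumComm (X Y : AsymptoticKasparovModule G A B) :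
    UnitaryEquiv (X.directSum Y) (Y.directSum X) where
  u :=
    { toFun := fun x : DSum (BL B) X.E Y.E => dpair (BL B) x.snd x.fst
      map_add' := fun _ _ => rfl
      map_smul' := fun _ _ => rfl }
  surjective := fun x : DSum (BL B) Y.E X.E => ⟨dpair (BL B) x.snd x.fst, rfl⟩
  rinner_u _ _ := add_comm _ _
  grade_u _ := rfl
  gact_u _ _ := rfl
  φ_u _ _ := rfl
  F_u _ := rfl

/-- Reassociating the summands. -/
def directSumAssoc (X Y Z : AsymptoticKasparovModule G A B) :
    UnitaryEquiv ((X.directSum Y).directSum Z) (X.directSum (Y.directSum Z)) where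
  u :=
    { toFun := fun x : DSum (BL B) (DSum (BL B) X.E Y.E) Z.E =>
        dpair (BL B) x.fst.fst (dpair (BL B) x.fst.snd x.snd)
      map_add' := fun _ _ => rfl
      map_smul' := fun _ _ => rfl }
  surjective := fun x : DSum (BL B) X.E (DSum (BL B) Y.E Z.E) =>
    ⟨dpair (BL B) (dpair (BL B) x.fst x.snd.fst) x.snd.snd, rfl⟩
  rinner_u _ _ := (add_assoc _ _ _).symm
  grade_u _ := rfl
  gact_u _ _ := rfl
  φ_u _ _ := rfl
  F_u _ := rfl

/-- A summand whose Hilbert module is zero can be dropped. -/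
def zeroDirectSum (Z X : AsymptoticKasparovModule G A B) [Subsingleton Z.E] :
    UnitaryEquiv (Z.directSum X) X where
  u :=
    { toFun := fun x : DSum (BL B) Z.E X.E => x.snd
      map_add' := fun _ _ => rfl
      map_smul' := fun _ _ => rfl }
  surjective ξ := ⟨dpair (BL B) 0 ξ, rfl⟩
  rinner_u := fun x y : DSum (BL B) Z.E X.E => by
    change rinner (BL B) x.snd y.snd = rinner (BL B) x.fst y.fst + rinner (BL B) x.snd y.snd
    rw [Subsingleton.elim x.fst 0, rinner_zero_left, zero_add]
  grade_u _ := rfl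
  gact_u _ _ := rfl
  φ_u _ _ := rfl
  F_u _ := rfl

/-- The zero vector space as a Hilbert module. -/
instance instCStarModulePUnit : CStarModule (BL B)ᵐᵒᵖ PUnit.{uB + 1} where
  inner _ _ := 0
  inner_add_right := (add_zero 0).symm
  inner_self_nonneg := le_rfl
  inner_self := ⟨fun _ => rfl, fun _ => rfl⟩
  inner_op_smul_right := (mul_zero _).symm
  inner_smul_right_complex := (smul_zero _).symm
  star_inner _ _ := star_zero _
  norm_eq_sqrt_norm_inner_self x := by
    rw [Subsingleton.elim x 0]; simp

end AsymptoticKasparovModule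

section Subsingleton

variable {E : Type*} [NormedAddCommGroup E] [NormedSpace ℂ E] [SMul (BL B)ᵐᵒᵖ E]
  [CStarModule (BL B)ᵐᵒᵖ E] [CompleteSpace E] [Subsingleton E]

lemma isVanishing_of_subsingleton (T : Adj (BL B) E) : IsVanishing T := fun ε hε =>
  Eventually.of_forall fun t ξ => by
    rw [Subsingleton.elim (T.1 ξ) 0]
    have h : fiberSeminorm B t (0 : E) = 0 := by simp [fiberSeminorm, rinner_zero_left]
    rw [h]
    exact mul_nonneg hε.le (fiberSeminorm_nonneg _ _)

lemma isNonnegModulo_of_subsingleton (T : Adj (BL B) E) : IsNonnegModulo T :=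
  ⟨0, 0, T, fun f => by rw [zero_mul]; exact Submodule.zero_mem _, isVanishing_of_subsingleton T,
    by simp⟩

end Subsingleton

namespace AsymptoticKasparovModule

variable (G A B) in
/-- The continuous field of modules whose Hilbert module is zero. -/
def zeroField : ContinuousField G A B where
  E := PUnit
  countablyGenerated := ⟨∅, Set.countable_empty, fun x => by
    rw [Subsingleton.elim x 0]; exact subset_closure (Submodule.zero_mem _)⟩
  grade := 0
  grade_grade _ := rfl
  grade_smul _ _ := rfl
  rinner_grade _ _ := (map_zero (BL.grade G)).symm
  gact _ := 0
  gact_one _ := rfl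
  gact_mul _ _ _ := rfl
  continuous_gact := continuous_const
  gact_smul _ _ _ := rfl
  rinner_gact g _ _ := (map_zero (BL.act g)).symm
  grade_gact _ _ := rfl
  φ := 0
  gact_φ _ _ _ := rfl
  grade_φ _ _ := rfl

instance : Subsingleton (zeroField G A B).E := inferInstanceAs (Subsingleton PUnit)

variable (G A B) in
/-- The asymptotic Kasparov module whose Hilbert module is zero. -/
def zero : AsymptoticKasparovModule G A B where
  toContinuousField := zeroField G A B
  F := 0
  odd_F _ := Subsingleton.elim _ _
  continuous_F := (continuous_const (y := (0 : Adj (BL B) (zeroField G A B).E))).congr fun _ =>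
    Subtype.ext <| ContinuousLinearMap.ext fun _ => Subsingleton.elim _ _
  akm1 _ := isVanishing_of_subsingleton _
  akm2 _ := isVanishing_of_subsingleton _
  akm3 _ := isNonnegModulo_of_subsingleton _
  akm4 _ _ := isVanishing_of_subsingleton _

instance : Subsingleton (zero G A B).E := inferInstanceAs (Subsingleton PUnit)

end AsymptoticKasparovModule

/-! ### The rotation of `(E ⊕ E^op, F ⊕ -F)` -/

section Swap

variable {D E : Type*} [NonUnitalCStarAlgebra D] [PartialOrder D] [StarOrderedRing D]
  [NormedAddCommGroup E] [NormedSpace ℂ E] [SMul Dᵐᵒᵖ E] [CStarModule Dᵐᵒᵖ E]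

variable (D E) in
/-- The interchange `(ξ, η) ↦ (η, ξ)` of the summands of `E ⊕ E`, as a bounded operator. -/
def swapCLM : DSum D E E →L[ℂ] DSum D E E :=
  ((WithCStarModule.equivL ℂ (A := Dᵐᵒᵖ) (E := E × E)).symm : E × E →L[ℂ] DSum D E E) ∘L
    ((ContinuousLinearMap.snd ℂ E E).prod (ContinuousLinearMap.fst ℂ E E)) ∘L
    ((WithCStarModule.equivL ℂ (A := Dᵐᵒᵖ) (E := E × E)) : DSum D E E →L[ℂ] E × E)

variable (D E) in
/-- The interchange of the summands of `E ⊕ E`, as an adjointable operator. -/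
def swapOp : Adj D (DSum D E E) :=
  Adj.mk (swapCLM D E) (swapCLM D E) fun _ _ => add_comm _ _

lemma swapOp_mul_self : swapOp D E * swapOp D E = 1 :=
  adj_dsum_ext (fun _ => rfl) (fun _ => rfl)

end Swap

namespace AsymptoticKasparovModule

/-- The function `s ↦ 1 - s`. -/
def rotationCos : C(I, ℝ) := ⟨fun s => 1 - s, by fun_prop⟩

/-- The function `d ≥ 0` with `d² = 1 - c²`, where `c s = 1 - s`. -/
def rotationSin : C(I, ℝ) := ⟨fun s => √(1 - (1 - (s : ℝ)) ^ 2), by fun_prop⟩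

/-- The interchange of the summands rotates `(E ⊕ E^op, F ⊕ -F)` into a degenerate module: the
interchange is odd since the grading of `E^op` is the opposite one. -/
def oppositeRotation (X : AsymptoticKasparovModule G A B) :
    Rotation (X.directSum X.opposite) rotationCos rotationSin where
  S := swapOp (BL B) X.E
  star_S := (eq_star_of_rinner (T := swapOp (BL B) X.E) fun _ _ => add_comm _ _).symm
  odd_S := fun x : DSum (BL B) X.E X.E =>
    dsum_ext (D := BL B) (neg_neg (X.grade x.snd)).symm rfl
  S_φ a := adj_dsum_ext (D := BL B) (E := X.E) (E' := X.E) (fun _ => rfl) fun x => by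
    change (X.φ a).1 x.fst = (X.φ (GradedGCStarAlgebra.grade G (GradedGCStarAlgebra.grade G a))).1
      x.fst
    rw [GradedGCStarAlgebra.grade_grade]
  conj_S g := adj_dsum_ext (D := BL B) (E := X.E) (E' := X.E)
    (fun x => by
      change X.gact g (X.gact g⁻¹ x.snd) = x.snd
      rw [← X.gact_mul, mul_inv_cancel, X.gact_one])
    fun x => by
      change X.gact g (X.gact g⁻¹ x.fst) = x.fst
      rw [← X.gact_mul, mul_inv_cancel, X.gact_one]
  anticomm := adj_dsum_ext (D := BL B) (E := X.E) (E' := X.E)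
    (fun x => add_neg_cancel (X.F.1 x.snd)) fun x => neg_add_cancel (X.F.1 x.fst)
  sq s := by
    have h : rotationSin s ^ 2 = 1 - rotationCos s ^ 2 := Real.sq_sqrt (by
      have h0 := s.2.1
      have h1 := s.2.2
      nlinarith)
    rw [h]
    exact congrArg _ (swapOp_mul_self (D := BL B) (E := X.E))

/-- `(E ⊕ E^op, F ⊕ -F)` is homotopic to the zero module: the homotopy rotates `F ⊕ -F` on
`C₀([0,1), E ⊕ E^op)`. -/
lemma homotopy_directSum_opposite (X : AsymptoticKasparovModule G A B) :
    Homotopy (X.directSum X.opposite) (zero G A B) :=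
  X.oppositeRotation.homotopy_zero (by simp [rotationCos]) (by simp [rotationSin])
    (by simp [rotationCos])

end AsymptoticKasparovModule

/-! ### The group `KE_G(A, B)` -/

namespace KE

open AsymptoticKasparovModule

lemma mk_eq_of_homotopy {X Y : AsymptoticKasparovModule G A B} (h : Homotopy X Y) :
    KE.mk X = KE.mk Y := Quot.sound h

lemma mk_eq_of_unitaryEquiv {X Y : AsymptoticKasparovModule G A B} (e : UnitaryEquiv X Y) :
    KE.mk X = KE.mk Y := mk_eq_of_homotopy e.homotopy

/-- The sum of classes, induced by the direct sum. -/
local instance instAdd : Add (KE G A B) where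
  add := Quot.map₂ AsymptoticKasparovModule.directSum
    (fun X _ _ h => (UnitaryEquiv.refl X).homotopy.directSum h)
    (fun _ _ Y h => h.directSum (UnitaryEquiv.refl Y).homotopy)

/-- The class of the zero module. -/
local instance instZero : Zero (KE G A B) where
  zero := KE.mk (zero G A B)

/-- The operation induced by `(E, F) ↦ (E^op, -F)`. -/
local instance instNeg : Neg (KE G A B) where
  neg := Quot.map AsymptoticKasparovModule.opposite fun _ _ h => h.opposite

/-- The abelian group structure of `KE_G(A, B)`. -/
abbrev addCommGroup : AddCommGroup (KE G A B) where
  add_assoc := by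
    rintro ⟨X⟩ ⟨Y⟩ ⟨Z⟩
    exact mk_eq_of_unitaryEquiv (directSumAssoc X Y Z)
  zero_add := by
    rintro ⟨X⟩
    exact mk_eq_of_unitaryEquiv (zeroDirectSum (zero G A B) X)
  add_zero := by
    rintro ⟨X⟩
    exact (mk_eq_of_unitaryEquiv (directSumComm X (zero G A B))).trans
      (mk_eq_of_unitaryEquiv (zeroDirectSum (zero G A B) X))
  add_comm := by
    rintro ⟨X⟩ ⟨Y⟩
    exact mk_eq_of_unitaryEquiv (directSumComm X Y)
  neg_add_cancel := by
    rintro ⟨X⟩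
    exact (mk_eq_of_unitaryEquiv (directSumComm X.opposite X)).trans
      (mk_eq_of_homotopy X.homotopy_directSum_opposite)
  nsmul := nsmulRec
  zsmul := zsmulRec

end KE

end Equivalences

end KETheory

end

theorem theoremT {G : Type*} {A : Type*} {B : Type*}
    [Group G] [TopologicalSpace G] [IsTopologicalGroup G] [LocallyCompactSpace G]
    [SigmaCompactSpace G] [T2Space G]
    [NonUnitalCStarAlgebra A] [TopologicalSpace.SeparableSpace A]
    [NonUnitalCStarAlgebra B] [TopologicalSpace.SeparableSpace B]
    [KETheory.GradedGCStarAlgebra G A] [KETheory.GradedGCStarAlgebra G B] :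
    ∃ _ : AddCommGroup (KETheory.KE G A B),
      (∀ X Y : KETheory.AsymptoticKasparovModule G A B,
        KETheory.KE.mk X + KETheory.KE.mk Y = KETheory.KE.mk (X.directSum Y)) ∧
      (∀ X : KETheory.AsymptoticKasparovModule G A B,
        -KETheory.KE.mk X = KETheory.KE.mk X.opposite) :=
  ⟨KETheory.KE.addCommGroup, fun _ _ => rfl, fun _ => rfl⟩
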